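/- Let $k\ge 1$, $V=\{0,\dots,k\}$, let $R,T$ be unary and $S_1,\dots,S_k$ binary relation symbols, pairwise distinct, and let $h_{k,0}=\exists x\exists y\,(R(x)\wedge S_1(x,y))$, $h_{k,i}=\exists x\exists y\,(S_i(x,y)\wedge S_{i+1}(x,y))$ for $1\le i<k$, and $h_{k,k}=\exists x\exists y\,(S_k(x,y)\wedge T(y))$. For a Boolean function $\varphi:2^V\to\{0,1\}$ let $Q_\varphi$ be the Boolean query obtained from $\varphi$ by substituting $h_{k,i}$ for each variable $i\in V$. The $\mathcal H^+$-queries are the queries $Q_\varphi$ with $k\ge 1$ and $\varphi$ monotone (they are equivalent to unions of conjunctive queries). Call $\varphi$ degenerate if there is a variable in $V$ on which it does not depend. For monotone $\varphi$, let $C_0\wedge\dots\wedge C_n$ be its unique minimized CNF, each clause being identified with the set of its variables, let $L=\{\bigcup_{i\in s}C_i : s\subseteq\{0,\dots,n\}\}$ be ordered by reversed inclusion, with least element $\hat 0=\bigcup_i C_i$ and greatest element $\hat 1=\emptyset$, and let $\mu$ be the Möbius function of the poset $L$. By the dichotomy criterion of Dalvi and Suciu, the $\mathcal H^+$-query $Q_\varphi$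 is safe if and only if $\varphi$ is degenerate or $\mu(\hat 0,\hat 1)=0$. A deterministic decomposable circuit (d-D) is a Boolean circuit with $\wedge$-, $\vee$-, $\neg$- and variable gates in which any two distinct inputs of an $\wedge$-gate depend on disjoint sets of variables, and any two distinct inputs of an $\vee$-gate capture disjoint Boolean functions. The lineage of a Boolean query $Q$ over a database $D$ is the Boolean function on the facts of $D$ that maps each $D'\subseteq D$ to the truth value of $Q$ on $D'$. **Corollary.** For every safe $\mathcal H^+$-query $Q_\varphi$ there is an algorithm which, given any database $D$ over the relations $R,S_1,\dots,S_k,T$, computes in time polynomial in the size of $D$ (data complexity: $k$ and $\varphi$ are fixed) a d-D that represents the lineage of $Q_\varphi$ over $D$. -/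

import Mathlib

namespace HQuery

/-! ### Boolean functions on `V = {0, …, k}` -/

/-- A Boolean function on the variables `V = {0, …, k}`; a valuation is a subset of `V`.
It is monotone in the usual sense iff it is `Monotone` for `⊆` and `false ≤ true`. -/
abbrev BoolFun (k : ℕ) : Type := Finset (Fin (k + 1)) → Bool

/-- The valuation `ν` with the membership of `l` flipped. -/
def flip {k : ℕ} (ν : Finset (Fin (k + 1))) (l : Fin (k + 1)) : Finset (Fin (k + 1)) :=
  if l ∈ ν then ν.erase l else insert l ν

/-- `φ` depends on the variable `l`. -/
def DependsOn {k : ℕ} (φ : BoolFun k) (l : Fin (k + 1)) : Prop :=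
  ∃ ν, φ ν ≠ φ (flip ν l)

/-- `φ` is nondegenerate when it depends on all its variables, and degenerate otherwise. -/
def Nondegenerate {k : ℕ} (φ : BoolFun k) : Prop := ∀ l, DependsOn φ l

/-! ### The CNF lattice, its Möbius function and safety -/

/-- `F` is a minimized CNF of the monotone function `φ`: a set of clauses (a clause being the
set of its variables), none of which is a subset of another, whose conjunction is `φ`. -/
def IsMinCNF {k : ℕ} (F : Finset (Finset (Fin (k + 1)))) (φ : BoolFun k) : Prop :=
  (∀ ν, φ ν = true ↔ ∀ C ∈ F, (C ∩ ν).Nonempty) ∧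
    IsAntichain (· ⊆ ·) (F : Set (Finset (Fin (k + 1))))

/-- The CNF lattice: the unions of subsets of the set `F` of clauses, ordered by reversed
inclusion. -/
abbrev CNFLattice {k : ℕ} (F : Finset (Finset (Fin (k + 1)))) : Type :=
  {d : (Finset (Fin (k + 1)))ᵒᵈ // ∃ s ⊆ F, OrderDual.ofDual d = s.biUnion id}

noncomputable instance {k : ℕ} (F : Finset (Finset (Fin (k + 1)))) : Fintype (CNFLattice F) :=
  Fintype.ofFinite _

open Classical in
noncomputable instance {k : ℕ} (F : Finset (Finset (Fin (k + 1)))) :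
    LocallyFiniteOrder (CNFLattice F) :=
  Fintype.toLocallyFiniteOrder

/-- The least element of the CNF lattice: the union of all clauses. -/
def latBot {k : ℕ} (F : Finset (Finset (Fin (k + 1)))) : CNFLattice F :=
  ⟨OrderDual.toDual (F.biUnion id), F, Finset.Subset.refl F, rfl⟩

/-- The greatest element of the CNF lattice: the empty union. -/
def latTop {k : ℕ} (F : Finset (Finset (Fin (k + 1)))) : CNFLattice F :=
  ⟨OrderDual.toDual ∅, ∅, Finset.empty_subset F, rfl⟩

open Classical in
/-- The value of the Möbius function of the CNF lattice from the least to the greatest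
element. -/
noncomputable def cnfMoebius {k : ℕ} (F : Finset (Finset (Fin (k + 1)))) : ℤ :=
  IncidenceAlgebra.mu ℤ (latBot F) (latTop F)

/-- The Dalvi–Suciu criterion for the UCQ `Q_φ`, `φ` monotone, to be safe: either `φ` is
degenerate, or the Möbius function of the CNF lattice of `φ` vanishes between the least and the
greatest element. -/
def IsSafe {k : ℕ} (φ : BoolFun k) : Prop :=
  ¬ Nondegenerate φ ∨ ∃ F, IsMinCNF F φ ∧ cnfMoebius F = 0

/-! ### Databases and queries -/

/-- Constants of databases are bit strings. -/
abbrev Const : Type := List Bool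

/-- Facts over the unary relations `R`, `T` and the binary relations `S_1, …, S_k`;
`S j` stands for `S_{j+1}`. -/
inductive Fact (k : ℕ) : Type
  | R (a : Const) : Fact k
  | S (j : Fin k) (a b : Const) : Fact k
  | T (b : Const) : Fact k
  deriving DecidableEq

/-- A database is a finite set of facts. -/
abbrev Database (k : ℕ) : Type := Finset (Fact k)

/-- A Boolean query. -/
abbrev Query (k : ℕ) : Type := Database k → Prop

/-- The atoms `R(x), S_1(x,y), …, S_k(x,y), T(y)`, numbered from `0` to `k + 1`. -/
def atom (k : ℕ) (j : ℕ) (x y : Const) : Fact k :=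
  if j = 0 then .R x
  else if h : j - 1 < k then .S ⟨j - 1, h⟩ x y
  else .T y

/-- `h_{k,i}`, i.e. (for `k ≥ 1`) `∃ x y, R(x) ∧ S_1(x,y)` if `i = 0`,
`∃ x y, S_i(x,y) ∧ S_{i+1}(x,y)` if `1 ≤ i < k`, and `∃ x y, S_k(x,y) ∧ T(y)` if `i = k`. -/
def h (k : ℕ) (i : Fin (k + 1)) : Query k := fun D =>
  ∃ x y : Const, atom k i x y ∈ D ∧ atom k (i + 1) x y ∈ D

open Classical in
/-- The query `Q_φ`, obtained from `φ` by substituting `h_{k,i}` for each variable `i`. -/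
noncomputable def Qof {k : ℕ} (φ : BoolFun k) : Query k := fun D =>
  φ (Finset.univ.filter fun i => h k i D) = true

/-! ### Circuits and d-Ds -/

/-- Gates of a Boolean circuit over the variables `X`; the numbers refer to the input gates.
The `∧`-gate (`∨`-gate) without inputs is the constant true (false). -/
inductive Gate (X : Type) : Type
  | var (x : X) : Gate X
  | not (i : ℕ) : Gate X
  | and (is : List ℕ) : Gate X
  | or (is : List ℕ) : Gate X

/-- The numbers of the input gates of a gate. -/
def Gate.inputs {X : Type} : Gate X → List ℕ
  | .var _ => []
  | .not i => [i]
  | .and is => is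
  | .or is => is

/-- A circuit is the list of its gates, in reverse topological order: the head of the list is the
output gate, and the number of a gate is the number of gates that come after it in the list. -/
abbrev Circuit (X : Type) : Type := List (Gate X)

namespace Circuit

/-- The Boolean function captured by gate number `i`; a valuation is the set `ν` of the variables
that are true. (A number that belongs to no gate gets the value false; this never matters for
well-formed circuits.) -/
def value {X : Type} (ν : Set X) : Circuit X → ℕ → Prop
  | [], _ => False
  | g :: c, n =>
    if n = c.length then
      match g with
      | .var x => x ∈ ν
      | .not i => ¬ value ν c i
      | .and is => ∀ i ∈ is, value ν c i
      | .or is => ∃ i ∈ is, value ν c i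
    else value ν c n

/-- The Boolean function captured by the circuit, i.e. by its output gate. -/
def output {X : Type} (ν : Set X) (c : Circuit X) : Prop := c.value ν (c.length - 1)

/-- The set of the variables from which there is a directed path to gate number `i`. -/
def vars {X : Type} : Circuit X → ℕ → Set X
  | [], _ => ∅
  | g :: c, n =>
    if n = c.length then
      match g with
      | .var x => {x}
      | .not i => vars c i
      | .and is => ⋃ i ∈ is, vars c i
      | .or is => ⋃ i ∈ is, vars c i
    else vars c n

/-- There is an output gate, all wires go to earlier gates, and the variables are in `V`. -/
def WellFormed {X : Type} (V : Set X) (c : Circuit X) : Prop :=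
  c ≠ [] ∧ (∀ g rest, (g :: rest) <:+ c → ∀ i ∈ g.inputs, i < rest.length) ∧
    ∀ x, Gate.var x ∈ c → x ∈ V

/-- Any two inputs of an `∧`-gate depend on disjoint sets of variables. -/
def Decomposable {X : Type} (c : Circuit X) : Prop :=
  ∀ is rest, (Gate.and is :: rest) <:+ c →
    is.Pairwise fun i j => Disjoint (vars rest i) (vars rest j)

/-- Any two inputs of an `∨`-gate capture disjoint Boolean functions. -/
def Deterministic {X : Type} (c : Circuit X) : Prop :=
  ∀ is rest, (Gate.or is :: rest) <:+ c →
    is.Pairwise fun i j => ∀ ν : Set X, ¬ (value ν rest i ∧ value ν rest j)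

/-- `c` is a deterministic decomposable circuit (d-D) on the variables `V`. -/
def IsDD {X : Type} (V : Set X) (c : Circuit X) : Prop :=
  c.WellFormed V ∧ c.Decomposable ∧ c.Deterministic

end Circuit

/-- The circuit `c` represents the lineage of `Q` over `D`, which is the Boolean function on the
facts of `D` that maps each `D' ⊆ D` to the truth value of `Q` on `D'`. -/
def RepresentsLineage {k : ℕ} (Q : Query k) (D : Database k) (c : Circuit (Fact k)) : Prop :=
  ∀ D' : Database k, D' ⊆ D → (c.output (D' : Set (Fact k)) ↔ Q D')

/-! ### The machine model: Jones's WHILE language over binary trees, with running times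

Programs have finitely many registers that hold binary trees, assignments, conditionals and
loops. Every operation is charged the full size of the trees that it reads and writes, so programs
and Turing machines simulate each other with polynomial overhead. -/

/-- The data of the programs: binary trees. -/
inductive Data : Type
  | nil : Data
  | node (l r : Data) : Data
  deriving DecidableEq

namespace Data

/-- The number of nodes, leaves included. -/
def size : Data → ℕ
  | nil => 1
  | node l r => l.size + r.size + 1

/-- The left subtree. -/
def hd : Data → Data
  | nil => nil
  | node l _ => l

/-- The right subtree. -/
def tl : Data → Data
  | nil => nil
  | node _ r => r

end Data

/-- The contents of the registers. -/
abbrev Store : Type := ℕ → Data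

/-- Expressions; `eq` tests whether two trees are equal. -/
inductive Expr : Type
  | reg (i : ℕ) : Expr
  | nil : Expr
  | cons (a b : Expr) : Expr
  | hd (a : Expr) : Expr
  | tl (a : Expr) : Expr
  | eq (a b : Expr) : Expr

namespace Expr

/-- The value of an expression; `nil` is the truth value false, other trees are true. -/
def eval (σ : Store) : Expr → Data
  | reg i => σ i
  | nil => .nil
  | cons a b => .node (a.eval σ) (b.eval σ)
  | hd a => (a.eval σ).hd
  | tl a => (a.eval σ).tl
  | eq a b => if a.eval σ = b.eval σ then .node .nil .nil else .nil

/-- The time to evaluate an expression: the total size of the values of all subexpressions. In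
particular copying, comparing or building a tree is charged at least the size of the tree. -/
def cost (σ : Store) : Expr → ℕ
  | reg i => (σ i).size
  | nil => 1
  | cons a b => a.cost σ + b.cost σ + (eval σ (cons a b)).size
  | hd a => a.cost σ + (eval σ (hd a)).size
  | tl a => a.cost σ + (eval σ (tl a)).size
  | eq a b => a.cost σ + b.cost σ + (eval σ (eq a b)).size

end Expr

/-- Programs. -/
inductive Prog : Type
  | assign (i : ℕ) (e : Expr) : Prog
  | seq (p q : Prog) : Prog
  | cond (e : Expr) (p q : Prog) : Prog
  | loop (e : Expr) (p : Prog) : Prog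

/-- `Exec p σ t σ'`: started in the store `σ`, the program `p` halts after time `t` in the
store `σ'`. -/
inductive Exec : Prog → Store → ℕ → Store → Prop
  | assign (i : ℕ) (e : Expr) (σ : Store) :
      Exec (.assign i e) σ (e.cost σ + 1) (Function.update σ i (e.eval σ))
  | seq {p q : Prog} {σ σ' σ'' : Store} {s t : ℕ} :
      Exec p σ s σ' → Exec q σ' t σ'' → Exec (.seq p q) σ (s + t) σ''
  | cond_true {e : Expr} {p q : Prog} {σ σ' : Store} {t : ℕ} :
      e.eval σ ≠ .nil → Exec p σ t σ' → Exec (.cond e p q) σ (e.cost σ + 1 + t) σ'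
  | cond_false {e : Expr} {p q : Prog} {σ σ' : Store} {t : ℕ} :
      e.eval σ = .nil → Exec q σ t σ' → Exec (.cond e p q) σ (e.cost σ + 1 + t) σ'
  | loop_true {e : Expr} {p : Prog} {σ σ' σ'' : Store} {s t : ℕ} :
      e.eval σ ≠ .nil → Exec p σ s σ' → Exec (.loop e p) σ' t σ'' →
      Exec (.loop e p) σ (e.cost σ + 1 + s + t) σ''
  | loop_false {e : Expr} {p : Prog} {σ : Store} :
      e.eval σ = .nil → Exec (.loop e p) σ (e.cost σ + 1) σ

/-- `p` maps the input `x` to the output `y` in time `t`: input and output are in register `0`,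
and all other registers are initially `nil`. -/
def Computes (p : Prog) (x : Data) (t : ℕ) (y : Data) : Prop :=
  ∃ σ' : Store, Exec p (Function.update (fun _ => .nil) 0 x) t σ' ∧ σ' 0 = y

/-! ### Encodings -/

/-- Natural numbers are encoded in unary. (Only gate numbers and relation names are numbers.) -/
def encNat : ℕ → Data
  | 0 => .nil
  | n + 1 => .node .nil (encNat n)

/-- Lists are encoded as iterated pairs. -/
def encList {α : Type} (enc : α → Data) : List α → Data
  | [] => .nil
  | a :: l => .node (enc a) (encList enc l)

def encBool : Bool → Data
  | false => .nil
  | true => .node .nil .nil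

def encConst (a : Const) : Data := encList encBool a

/-- A fact is the number of its relation, paired with its arguments. -/
def encFact {k : ℕ} : Fact k → Data
  | .R a => .node (encNat 0) (encConst a)
  | .S j a b => .node (encNat (j + 1)) (.node (encConst a) (encConst b))
  | .T b => .node (encNat (k + 1)) (encConst b)

/-- A gate is the number of its kind, paired with its variable or its inputs. -/
def encGate {k : ℕ} : Gate (Fact k) → Data
  | .var x => .node (encNat 0) (encFact x)
  | .not i => .node (encNat 1) (encNat i)
  | .and is => .node (encNat 2) (encList encNat is)
  | .or is => .node (encNat 3) (encList encNat is)

def encCircuit {k : ℕ} (c : Circuit (Fact k)) : Data := encList encGate c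

/-! The encodings of databases and circuits are injective. -/

theorem encNat_injective : Function.Injective encNat := by
  intro a
  induction a with
  | zero => intro b h; cases b <;> simp_all [encNat]
  | succ n ih =>
    intro b h
    cases b with
    | zero => simp [encNat] at h
    | succ m => simp [encNat] at h; rw [ih h]

theorem encList_injective {α : Type} {enc : α → Data} (he : Function.Injective enc) :
    Function.Injective (encList enc) := by
  intro a
  induction a with
  | nil => intro b h; cases b <;> simp_all [encList]
  | cons x l ih =>
    intro b h
    cases b with
    | nil => simp [encList] at h
    | cons y m => simp [encList] at h; rw [ih h.2, he h.1]

theorem encConst_injective : Function.Injective encConst :=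
  encList_injective (by intro a b; cases a <;> cases b <;> simp [encBool])

theorem encFact_injective {k : ℕ} : Function.Injective (encFact (k := k)) := by
  intro a b h
  cases a <;> cases b <;>
    simp only [encFact, Data.node.injEq, encNat_injective.eq_iff,
      encConst_injective.eq_iff] at h <;>
    simp <;> grind

theorem encCircuit_injective {k : ℕ} : Function.Injective (encCircuit (k := k)) := by
  refine encList_injective ?_
  intro a b h
  cases a <;> cases b <;>
    simp [encGate, encNat_injective.eq_iff, (encList_injective encNat_injective).eq_iff,
      encFact_injective.eq_iff] at h <;>
    simp [h]

/-- The class d-D(PTIME), in data complexity: there is a program (it may depend on the query)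
which, given any database as a list of its facts in any order, computes in time polynomial in the
size of this input a d-D that represents the lineage of the query over the database. -/
def InDDPTIME {k : ℕ} (Q : Query k) : Prop :=
  ∃ (p : Prog) (P : Polynomial ℕ), ∀ l : List (Fact k),
    ∃ (c : Circuit (Fact k)) (t : ℕ),
      Computes p (encList encFact l) t (encCircuit c) ∧
      t ≤ P.eval (encList encFact l).size ∧
      c.IsDD (l.toFinset : Set (Fact k)) ∧
      RepresentsLineage Q l.toFinset c

end HQuery

/-!
Let `e(φ) = ∑_{ν ⊨ φ} (-1)^|ν|`. If `φ` does not depend on `l`, flipping `l` pairs off the terms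
of `e(φ)`. If `φ` is given by a minimized CNF, inclusion and exclusion on the clauses together with
Möbius inversion give `e(φ) = μ(0̂, 1̂)`, or `e(φ) = 0` when the clauses do not cover `V`. So
`e(φ) = 0` for every safe `φ`.

A set of valuations with vanishing `e` is obtained from `∅` by adding disjoint edges of the
hypercube and taking complements: these operations allow a valuation to slide two steps along a path
of the hypercube, hence to any valuation of the same parity. Slide one valuation next to a
valuation of the opposite parity, remove the resulting edge, and repeat.

An edge `{ν, ν ∆ {l}}` prescribes the truth values of all `h_{k,i}` except `h_{k,l}`. The queries
with `i < l` only mention `R, S_1, …, S_l`, those with `i > l` only `S_{l+1}, …, S_k, T`, so the two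
groups have disjoint lineages. After sorting the facts by the constant which the atoms of the group
share, a finite automaton that reads every fact once decides each group, and unfolding its run is a
d-D of polynomial size. Adding a disjoint edge is a deterministic `∨`, complementing is a `¬`.
-/

namespace HQuery

/-! ### Polynomial-time functions -/

theorem Data.size_pos (d : Data) : 0 < d.size := by cases d <;> simp [Data.size]

theorem Data.size_hd_le (d : Data) : d.hd.size ≤ d.size := by
  cases d <;> simp only [hd, size] <;> omega

theorem Data.size_tl_le (d : Data) : d.tl.size ≤ d.size := by
  cases d <;> simp only [tl, size] <;> omega

theorem Expr.size_eval_le_cost (σ : Store) (e : Expr) : (e.eval σ).size ≤ e.cost σ := by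
  cases e <;> simp [Expr.eval, Expr.cost, Data.size]

theorem Exec.size_le {p : Prog} {σ σ' : Store} {t : ℕ} (h : Exec p σ t σ') (j : ℕ) :
    (σ' j).size ≤ (σ j).size + t := by
  induction h with
  | assign i e σ =>
    by_cases hj : j = i
    · subst hj
      have := e.size_eval_le_cost σ
      simp only [Function.update_self]
      omega
    · simp [Function.update_of_ne hj]
  | seq _ _ ih₁ ih₂ => omega
  | cond_true _ _ ih => omega
  | cond_false _ _ ih => omega
  | loop_true _ _ _ ih₁ ih₂ => omega
  | loop_false _ => omega

/-- The program `p`, started in the store `σ`, halts in the store `σ'` after time at most `T`. -/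
def ExecWithin (p : Prog) (σ : Store) (T : ℕ) (σ' : Store) : Prop :=
  ∃ t ≤ T, Exec p σ t σ'

namespace ExecWithin
variable {p q : Prog} {e : Expr} {d : Data} {σ σ' σ'' : Store} {S T K : ℕ} {i : ℕ}

theorem mono (h : ExecWithin p σ S σ') (hST : S ≤ T) : ExecWithin p σ T σ' :=
  let ⟨t, ht, he⟩ := h
  ⟨t, ht.trans hST, he⟩

theorem size_le (h : ExecWithin p σ T σ') (j : ℕ) : (σ' j).size ≤ (σ j).size + T :=
  let ⟨_, ht, he⟩ := h
  (he.size_le j).trans (Nat.add_le_add_left ht _)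

theorem assign (he : e.eval σ = d) (hT : e.cost σ < T) :
    ExecWithin (.assign i e) σ T (Function.update σ i d) :=
  ⟨_, hT, he ▸ .assign i e σ⟩

theorem seq (hp : ExecWithin p σ S σ') (hq : ExecWithin q σ' T σ'') :
    ExecWithin (.seq p q) σ (S + T) σ'' :=
  let ⟨_, hs, hp⟩ := hp
  let ⟨_, ht, hq⟩ := hq
  ⟨_, add_le_add hs ht, hp.seq hq⟩

theorem cond_true (he : e.eval σ ≠ .nil) (hp : ExecWithin p σ T σ') :
    ExecWithin (.cond e p q) σ (e.cost σ + 1 + T) σ' :=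
  let ⟨_, ht, hp⟩ := hp
  ⟨_, Nat.add_le_add_left ht _, .cond_true he hp⟩

theorem cond_false (he : e.eval σ = .nil) (hq : ExecWithin q σ T σ') :
    ExecWithin (.cond e p q) σ (e.cost σ + 1 + T) σ' :=
  let ⟨_, ht, hq⟩ := hq
  ⟨_, Nat.add_le_add_left ht _, .cond_false he hq⟩

theorem loop_true (he : e.eval σ ≠ .nil) (hp : ExecWithin p σ S σ')
    (hl : ExecWithin (.loop e p) σ' T σ'') :
    ExecWithin (.loop e p) σ (e.cost σ + 1 + S + T) σ'' :=
  let ⟨_, hs, hp⟩ := hp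
  let ⟨_, ht, hl⟩ := hl
  ⟨_, add_le_add (Nat.add_le_add_left hs _) ht, .loop_true he hp hl⟩

theorem loop_false (he : e.eval σ = .nil) : ExecWithin (.loop e p) σ (e.cost σ + 1) σ :=
  ⟨_, le_rfl, .loop_false he⟩

end ExecWithin

/-- Types whose elements are encoded as data of programs. -/
class Enc (α : Type) where
  /-- The encoding. It need not be injective. -/
  enc : α → Data

open Enc (enc)

instance : Enc Data := ⟨id⟩
instance : Enc Unit := ⟨fun _ => .nil⟩
instance : Enc ℕ := ⟨encNat⟩
instance : Enc Bool := ⟨encBool⟩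
instance {n : ℕ} : Enc (Fin n) := ⟨fun i => encNat i⟩
instance {α β : Type} [Enc α] [Enc β] : Enc (α × β) := ⟨fun x => .node (enc x.1) (enc x.2)⟩
instance {α : Type} [Enc α] : Enc (List α) := ⟨encList enc⟩
instance {α : Type} [Enc α] : Enc (Option α) := ⟨fun o => enc o.toList⟩
instance {k : ℕ} : Enc (Fact k) := ⟨encFact⟩
instance {k : ℕ} : Enc (Gate (Fact k)) := ⟨encGate⟩

theorem enc_fin_injective {n : ℕ} : Function.Injective (enc : Fin n → Data) :=
  encNat_injective.comp Fin.val_injective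

theorem enc_option_injective {α : Type} [Enc α] (h : Function.Injective (enc : α → Data)) :
    Function.Injective (enc : Option α → Data) := by
  refine (encList_injective h).comp fun o o' h => ?_
  cases o <;> cases o' <;> simp_all

/-- The size of the encoding. -/
def encSize {α : Type} [Enc α] (a : α) : ℕ := (enc a).size

section
variable {α β γ : Type} [Enc α] [Enc β] [Enc γ]

theorem encSize_pos (a : α) : 0 < encSize a := Data.size_pos _

theorem encSize_prod (a : α) (b : β) : encSize (a, b) = encSize a + encSize b + 1 := rfl

theorem encSize_nat (n : ℕ) : encSize n = 2 * n + 1 := by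
  induction n with
  | zero => rfl
  | succ n ih =>
    have : encSize (n + 1) = 1 + encSize n + 1 := rfl
    omega

theorem encSize_bool_le (b : Bool) : encSize b ≤ 3 := by
  cases b <;> simp [encSize, enc, encBool, Data.size]

theorem encSize_cons (a : α) (l : List α) : encSize (a :: l) = encSize a + encSize l + 1 := rfl

theorem encSize_list (l : List α) : encSize l = (l.map fun a => encSize a + 1).sum + 1 := by
  induction l with
  | nil => rfl
  | cons a l ih => rw [encSize_cons, ih, List.map_cons, List.sum_cons]; omega

theorem encSize_append (l m : List α) : encSize (l ++ m) + 1 = encSize l + encSize m := by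
  simp only [encSize_list, List.map_append, List.sum_append]
  omega

theorem encSize_reverse (l : List α) : encSize l.reverse = encSize l := by
  simp only [encSize_list, List.map_reverse, List.sum_reverse]

theorem encSize_le_of_sublist {l m : List α} (h : l.Sublist m) : encSize l ≤ encSize m := by
  simp only [encSize_list]
  exact Nat.add_le_add_right ((h.map _).sum_le_sum fun _ _ => Nat.zero_le _) 1

theorem encSize_lt_of_mem {a : α} {l : List α} (h : a ∈ l) : encSize a < encSize l := by
  have := encSize_le_of_sublist (List.singleton_sublist.2 h)
  rw [encSize_cons] at this
  omega

theorem length_lt_encSize (l : List α) : l.length < encSize l := by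
  induction l with
  | nil => exact encSize_pos _
  | cons a l ih => rw [encSize_cons, List.length_cons]; omega

theorem monotone_polynomial_eval (P : Polynomial ℕ) : Monotone fun n => P.eval n := by
  intro m n hmn
  simp only [Polynomial.eval_eq_sum, Polynomial.sum]
  exact Finset.sum_le_sum fun i _ => Nat.mul_le_mul_left _ (Nat.pow_le_pow_left hmn i)

/-- The function `T` is bounded by a polynomial in the size of the encoding. -/
def PolyBounded (T : α → ℕ) : Prop := ∃ P : Polynomial ℕ, ∀ a, T a ≤ P.eval (encSize a)

namespace PolyBounded
variable {S T : α → ℕ}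

theorem encSize_self : PolyBounded fun a : α => encSize a := ⟨.X, fun _ => by simp⟩

theorem const (n : ℕ) : PolyBounded fun _ : α => n := ⟨.C n, fun _ => by simp⟩

theorem mono (hT : PolyBounded T) (hST : ∀ a, S a ≤ T a) : PolyBounded S :=
  let ⟨P, hP⟩ := hT
  ⟨P, fun a => (hST a).trans (hP a)⟩

theorem add (hS : PolyBounded S) (hT : PolyBounded T) : PolyBounded fun a => S a + T a := by
  obtain ⟨P, hP⟩ := hS
  obtain ⟨Q, hQ⟩ := hT
  exact ⟨P + Q, fun a => by simpa using add_le_add (hP a) (hQ a)⟩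

theorem mul (hS : PolyBounded S) (hT : PolyBounded T) : PolyBounded fun a => S a * T a := by
  obtain ⟨P, hP⟩ := hS
  obtain ⟨Q, hQ⟩ := hT
  exact ⟨P * Q, fun a => by simpa using Nat.mul_le_mul (hP a) (hQ a)⟩

theorem exists_bound_of_encSize_le {S : β → ℕ} (hS : PolyBounded S) (hT : PolyBounded T) :
    ∃ B : α → ℕ, PolyBounded B ∧ ∀ a b, encSize b ≤ T a → S b ≤ B a := by
  obtain ⟨P, hP⟩ := hS
  obtain ⟨Q, hQ⟩ := hT
  exact ⟨fun a => P.eval (T a), ⟨P.comp Q, fun a => by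
    simpa only [Polynomial.eval_comp] using monotone_polynomial_eval P (hQ a)⟩, fun a b hab =>
      (hP b).trans (monotone_polynomial_eval P hab)⟩

theorem comp {S : β → ℕ} {f : α → β} (hS : PolyBounded S)
    (hf : PolyBounded fun a => encSize (f a)) : PolyBounded fun a => S (f a) :=
  let ⟨_, hB, hSB⟩ := hS.exists_bound_of_encSize_le hf
  hB.mono fun a => hSB a (f a) le_rfl

end PolyBounded

/-- The program `p` replaces the content of register `i`, which encodes an element `a` of `α`, by
the encoding of `f a` in time at most `T a`. The registers before `i` are preserved and those
after `i` are available for intermediate results. -/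
def Realizes (f : α → β) (T : α → ℕ) (i : ℕ) (p : Prog) : Prop :=
  ∀ (σ : Store) (a : α), σ i = enc a →
    ∃ σ', ExecWithin p σ (T a) σ' ∧ σ' i = enc (f a) ∧ ∀ j < i, σ' j = σ j

/-- The program that applies `p` to a copy of register `i` in register `j`. -/
def copyThen (i j : ℕ) (p : Prog) : Prog := .seq (.assign j (.reg i)) p

namespace Realizes
variable {f : α → β} {T : α → ℕ} {i j : ℕ} {p : Prog}

theorem assign {e : Expr} (he : ∀ σ a, σ i = enc a → e.eval σ = enc (f a) ∧ e.cost σ < T a) :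
    Realizes f T i (.assign i e) := fun σ a ha =>
  ⟨_, .assign (he σ a ha).1 (he σ a ha).2, Function.update_self .., fun _ hj =>
    Function.update_of_ne hj.ne ..⟩

theorem exec_copyThen (hp : Realizes f T j p) {σ : Store} {a : α} (ha : σ i = enc a) :
    ∃ σ', ExecWithin (copyThen i j p) σ (encSize a + 1 + T a) σ' ∧
      σ' j = enc (f a) ∧ ∀ m < j, σ' m = σ m := by
  obtain ⟨σ', hexec, hval, hold⟩ := hp (Function.update σ j (enc a)) a (Function.update_self ..)
  refine ⟨σ', .seq (.assign (by simp [Expr.eval, ha]) ?_) hexec, hval, fun m hm => ?_⟩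
  · simp [Expr.cost, ha, encSize]
  · rw [hold m hm, Function.update_of_ne hm.ne]

end Realizes

/-- The function `f` is computable in polynomial time. -/
def PolyTime (f : α → β) : Prop :=
  ∃ T : α → ℕ, PolyBounded T ∧ ∀ i, ∃ p, Realizes f T i p

namespace PolyTime

theorem polyBounded {f : α → β} (hf : PolyTime f) : PolyBounded fun a => encSize (f a) := by
  obtain ⟨T, hT, h⟩ := hf
  obtain ⟨p, hp⟩ := h 0
  refine (PolyBounded.encSize_self.add hT).mono fun a => ?_
  obtain ⟨σ', hexec, hval, -⟩ := hp (fun _ => enc a) a rfl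
  simpa only [encSize, hval] using hexec.size_le 0

theorem of_enc_eq {f : α → Data} {g : α → β} (hf : PolyTime f) (h : ∀ a, enc (g a) = f a) :
    PolyTime g := by
  obtain ⟨T, hT, hp⟩ := hf
  refine ⟨T, hT, fun i => (hp i).imp fun p hp σ a ha => ?_⟩
  rw [h]
  exact hp σ a ha

theorem toData : PolyTime fun a : α => enc a :=
  ⟨fun a => encSize a + 1, PolyBounded.encSize_self.add (.const 1), fun i =>
    ⟨.assign i (.reg i), .assign fun _ _ ha =>
      ⟨ha, by simp only [Expr.cost, ha]; exact Nat.lt_succ_self _⟩⟩⟩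

theorem id : PolyTime fun a : α => a := of_enc_eq toData fun _ => rfl

theorem hd : PolyTime Data.hd := by
  refine ⟨fun d => 2 * d.size + 1, ((PolyBounded.const 2).mul .encSize_self).add (.const 1),
    fun i => ⟨.assign i (.hd (.reg i)), .assign fun σ d hd => ?_⟩⟩
  change σ i = d at hd
  have := d.size_hd_le
  simp only [Expr.eval, Expr.cost, hd]
  exact ⟨rfl, by omega⟩

theorem tl : PolyTime Data.tl := by
  refine ⟨fun d => 2 * d.size + 1, ((PolyBounded.const 2).mul .encSize_self).add (.const 1),
    fun i => ⟨.assign i (.tl (.reg i)), .assign fun σ d hd => ?_⟩⟩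
  change σ i = d at hd
  have := d.size_tl_le
  simp only [Expr.eval, Expr.cost, hd]
  exact ⟨rfl, by omega⟩

end PolyTime

/-- The expression without registers that denotes `d`. -/
def Data.toExpr : Data → Expr
  | nil => .nil
  | node l r => .cons l.toExpr r.toExpr

theorem Data.eval_toExpr (σ : Store) (d : Data) : d.toExpr.eval σ = d := by
  induction d <;> simp_all [Data.toExpr, Expr.eval]

theorem Data.cost_toExpr (σ τ : Store) (d : Data) : d.toExpr.cost σ = d.toExpr.cost τ := by
  induction d <;> simp_all [Data.toExpr, Expr.cost, Expr.eval, Data.eval_toExpr]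

namespace PolyTime

theorem const (b : β) : PolyTime fun _ : α => b :=
  ⟨fun _ => (enc b).toExpr.cost (fun _ => .nil) + 1, .const _, fun i =>
    ⟨.assign i (enc b).toExpr, .assign fun σ _ _ =>
      ⟨Data.eval_toExpr σ _, by rw [Data.cost_toExpr σ]; exact Nat.lt_succ_self _⟩⟩⟩

theorem comp {g : β → γ} {f : α → β} (hg : PolyTime g) (hf : PolyTime f) :
    PolyTime fun a => g (f a) := by
  have hsize := hf.polyBounded
  obtain ⟨S, hS, hf⟩ := hf
  obtain ⟨T, hT, hg⟩ := hg
  refine ⟨fun a => S a + T (f a), hS.add (hT.comp hsize), fun i => ?_⟩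
  obtain ⟨p, hp⟩ := hf i
  obtain ⟨q, hq⟩ := hg i
  refine ⟨.seq p q, fun σ a ha => ?_⟩
  obtain ⟨σ₁, hexec₁, hval₁, hold₁⟩ := hp σ a ha
  obtain ⟨σ₂, hexec₂, hval₂, hold₂⟩ := hq σ₁ (f a) hval₁
  exact ⟨σ₂, hexec₁.seq hexec₂, hval₂, fun j hj => (hold₂ j hj).trans (hold₁ j hj)⟩

theorem fst : PolyTime (Prod.fst : α × β → α) := of_enc_eq (hd.comp toData) fun _ => rfl

theorem snd : PolyTime (Prod.snd : α × β → β) := of_enc_eq (tl.comp toData) fun _ => rfl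

theorem pair {f : α → β} {g : α → γ} (hf : PolyTime f) (hg : PolyTime g) :
    PolyTime fun a => (f a, g a) := by
  have hfsize := hf.polyBounded
  have hgsize := hg.polyBounded
  obtain ⟨S, hS, hf⟩ := hf
  obtain ⟨T, hT, hg⟩ := hg
  refine ⟨fun a => encSize a + 1 + S a + (encSize a + 1 + T a +
      (2 * (encSize (f a) + encSize (g a)) + 2)),
    ((PolyBounded.encSize_self.add (.const 1)).add hS).add
      (((PolyBounded.encSize_self.add (.const 1)).add hT).add
        (((PolyBounded.const 2).mul (hfsize.add hgsize)).add (.const 2))), fun i => ?_⟩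
  obtain ⟨p, hp⟩ := hf (i + 1)
  obtain ⟨q, hq⟩ := hg (i + 2)
  refine ⟨.seq (copyThen i (i + 1) p) (.seq (copyThen i (i + 2) q)
    (.assign i (.cons (.reg (i + 1)) (.reg (i + 2))))), fun σ a ha => ?_⟩
  obtain ⟨σ₁, hexec₁, hval₁, hold₁⟩ := hp.exec_copyThen ha
  obtain ⟨σ₂, hexec₂, hval₂, hold₂⟩ := hq.exec_copyThen ((hold₁ i (by omega)).trans ha)
  have hval₁' : σ₂ (i + 1) = enc (f a) := (hold₂ _ (by omega)).trans hval₁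
  refine ⟨_, hexec₁.seq (hexec₂.seq (.assign (d := enc (f a, g a)) ?_ ?_)),
    Function.update_self .., fun j hj => ?_⟩
  · simp only [Expr.eval, hval₁', hval₂]
    rfl
  · simp only [Expr.cost, Expr.eval, hval₁', hval₂, Data.size, encSize]
    omega
  · rw [Function.update_of_ne hj.ne, hold₂ j (by omega), hold₁ j (by omega)]

theorem ite {c : α → Bool} {f g : α → β} (hc : PolyTime c) (hf : PolyTime f) (hg : PolyTime g) :
    PolyTime fun a => if c a then f a else g a := by
  obtain ⟨R, hR, hc⟩ := hc
  obtain ⟨S, hS, hf⟩ := hf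
  obtain ⟨T, hT, hg⟩ := hg
  refine ⟨fun a => encSize a + 1 + R a + (4 + (S a + T a)),
    ((PolyBounded.encSize_self.add (.const 1)).add hR).add ((PolyBounded.const 4).add (hS.add hT)),
    fun i => ?_⟩
  obtain ⟨r, hr⟩ := hc (i + 1)
  obtain ⟨p, hp⟩ := hf i
  obtain ⟨q, hq⟩ := hg i
  refine ⟨.seq (copyThen i (i + 1) r) (.cond (.reg (i + 1)) p q), fun σ a ha => ?_⟩
  obtain ⟨σ₁, hexec₁, hval₁, hold₁⟩ := hr.exec_copyThen ha
  have ha₁ : σ₁ i = enc a := (hold₁ i (by omega)).trans ha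
  have hcost : Expr.cost σ₁ (.reg (i + 1)) ≤ 3 := by
    simpa only [Expr.cost, hval₁, encSize] using encSize_bool_le (c a)
  cases hca : c a
  · obtain ⟨σ₂, hexec₂, hval₂, hold₂⟩ := hq σ₁ a ha₁
    refine ⟨σ₂, hexec₁.seq ((ExecWithin.cond_false ?_ hexec₂).mono (by omega)),
      by simp [hval₂, hca], fun j hj => (hold₂ j hj).trans (hold₁ j (by omega))⟩
    simp [Expr.eval, hval₁, hca, enc, encBool]
  · obtain ⟨σ₂, hexec₂, hval₂, hold₂⟩ := hp σ₁ a ha₁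
    refine ⟨σ₂, hexec₁.seq ((ExecWithin.cond_true ?_ hexec₂).mono (by omega)),
      by simp [hval₂, hca], fun j hj => (hold₂ j hj).trans (hold₁ j (by omega))⟩
    simp [Expr.eval, hval₁, hca, enc, encBool]

theorem decide_eq [DecidableEq β] (hinj : Function.Injective (enc : β → Data)) {f g : α → β}
    (hf : PolyTime f) (hg : PolyTime g) : PolyTime fun a => decide (f a = g a) := by
  suffices h : PolyTime fun x : β × β => decide (x.1 = x.2) from h.comp (hf.pair hg)
  refine ⟨fun x => 3 * encSize x + 4, ((PolyBounded.const 3).mul .encSize_self).add (.const 4),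
    fun i => ⟨.assign i (.eq (.hd (.reg i)) (.tl (.reg i))), .assign ?_⟩⟩
  rintro σ ⟨b, b'⟩ hx
  replace hx : σ i = .node (enc b) (enc b') := hx
  by_cases h : b = b'
  all_goals
    simp only [Expr.eval, Expr.cost, hx, Data.hd, Data.tl, Data.size, encSize_prod, hinj.eq_iff, h,
      if_true, if_false, decide_true, decide_false]
    exact ⟨rfl, by simp only [encSize]; omega⟩

theorem exists_computes {f : α → β} (hf : PolyTime f) :
    ∃ (p : Prog) (P : Polynomial ℕ), ∀ a, ∃ t,
      Computes p (enc a) t (enc (f a)) ∧ t ≤ P.eval (encSize a) := by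
  obtain ⟨T, ⟨P, hP⟩, h⟩ := hf
  obtain ⟨p, hp⟩ := h 0
  refine ⟨p, P, fun a => ?_⟩
  obtain ⟨σ', ⟨t, ht, hexec⟩, hval, -⟩ :=
    hp (Function.update (fun _ => .nil) 0 (enc a)) a (Function.update_self ..)
  exact ⟨t, ⟨σ', hexec, hval⟩, ht.trans (hP a)⟩

end PolyTime

/-- The registers from `i` on hold the parameter, the remaining list and the accumulator of a left
fold. -/
def FoldState (i : ℕ) (x : α) (l : List β) (c : γ) (σ : Store) : Prop :=
  σ i = enc x ∧ σ (i + 1) = enc l ∧ σ (i + 2) = enc c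

/-- One iteration of a left fold, where `p` computes the new accumulator in register `i + 3`. -/
def foldBody (i : ℕ) (p : Prog) : Prog :=
  .seq (.assign (i + 3) (.cons (.reg i) (.cons (.hd (.reg (i + 1))) (.reg (i + 2)))))
    (.seq p (.seq (.assign (i + 2) (.reg (i + 3))) (.assign (i + 1) (.tl (.reg (i + 1))))))

/-- The left fold as a program. -/
def foldLoop (i : ℕ) (p : Prog) : Prog := .loop (.reg (i + 1)) (foldBody i p)

/-- A bound for the time of one iteration of a left fold with the step function `f`, which is
computed in time `T`, including the test for the end of the list. -/
def iterTime (f : α × β × γ → γ) (T : α × β × γ → ℕ) (x : α) (b : β) (l : List β) (c : γ) : ℕ :=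
  T (x, b, c) + 7 * (encSize x + encSize (b :: l) + encSize c + encSize (f (x, b, c)) + 1)

namespace Realizes
variable {f : α × β × γ → γ} {T : α × β × γ → ℕ} {i : ℕ} {p : Prog}

theorem exec_foldBody (hp : Realizes f T (i + 3) p) {x : α} {b : β} {l : List β} {c : γ}
    {σ : Store} (h : FoldState i x (b :: l) c σ) :
    ∃ σ', ExecWithin (foldBody i p) σ (T (x, b, c) + 6 * (encSize x + encSize (b :: l) +
        encSize c + encSize (f (x, b, c)) + 1)) σ' ∧
      FoldState i x l (f (x, b, c)) σ' ∧ ∀ j < i, σ' j = σ j := by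
  obtain ⟨hx, hl, hc⟩ := h
  replace hl : σ (i + 1) = .node (enc b) (enc l) := hl
  obtain ⟨σ₁, hexec, hval, hold⟩ :=
    hp (Function.update σ (i + 3) (enc (x, b, c))) (x, b, c) (Function.update_self ..)
  have hold' : ∀ j < i + 3, σ₁ j = σ j := fun j hj => by
    rw [hold j hj, Function.update_of_ne hj.ne]
  have hl₁ : σ₁ (i + 1) = .node (enc b) (enc l) := (hold' _ (by omega)).trans hl
  refine ⟨Function.update (Function.update σ₁ (i + 2) (enc (f (x, b, c)))) (i + 1) (enc l),
    ((ExecWithin.assign ?_ (Nat.lt_succ_self _)).seq (hexec.seq ((ExecWithin.assign ?_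
      (Nat.lt_succ_self _)).seq (.assign ?_ (Nat.lt_succ_self _))))).mono ?_,
    ⟨?_, by simp, by simp⟩, fun j hj => ?_⟩
  · simp only [Expr.eval, hx, hl, hc, Data.hd]
    rfl
  · exact hval
  · simp [Expr.eval, hl₁, Data.tl]
  · simp only [Expr.cost, Expr.eval, hx, hl, hc, Data.hd, Data.tl, Data.size, hl₁, hval,
      Function.update_of_ne (show i + 1 ≠ i + 2 by omega), encSize_cons]
    simp only [encSize]
    omega
  · simp [hold', hx]
  · rw [Function.update_of_ne (by omega), Function.update_of_ne (by omega), hold' j (by omega)]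

theorem exec_foldLoop (hp : Realizes f T (i + 3) p) {N : ℕ} {x : α} {l : List β} {c : γ}
    {σ : Store} (h : FoldState i x l c σ)
    (hN : ∀ l₁ b l₂, l = l₁ ++ b :: l₂ →
      iterTime f T x b l₂ (l₁.foldl (fun c b => f (x, b, c)) c) ≤ N) :
    ∃ σ', ExecWithin (foldLoop i p) σ (l.length * N + 2) σ' ∧
      σ' (i + 2) = enc (l.foldl (fun c b => f (x, b, c)) c) ∧ ∀ j < i, σ' j = σ j := by
  induction l generalizing c σ with
  | nil =>
    have hl : σ (i + 1) = .nil := h.2.1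
    refine ⟨σ, (ExecWithin.loop_false (by simp [Expr.eval, hl])).mono ?_, h.2.2, fun _ _ => rfl⟩
    simp [Expr.cost, hl, Data.size]
  | cons b l ih =>
    have hl : σ (i + 1) = enc (b :: l) := h.2.1
    obtain ⟨σ₁, hexec₁, h₁, hold₁⟩ := hp.exec_foldBody h
    obtain ⟨σ₂, hexec₂, hval₂, hold₂⟩ := ih h₁ fun l₁ b' l₂ hl => hN (b :: l₁) b' l₂ (by simp [hl])
    refine ⟨σ₂, (ExecWithin.loop_true ?_ hexec₁ hexec₂).mono ?_, hval₂, fun j hj =>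
      (hold₂ j hj).trans (hold₁ j hj)⟩
    · simp [Expr.eval, hl, enc, encList]
    · have hiter := hN [] b l rfl
      rw [iterTime, List.foldl_nil] at hiter
      have hcost : Expr.cost σ (.reg (i + 1)) = encSize (b :: l) := by simp [Expr.cost, hl, encSize]
      rw [List.length_cons, add_mul, hcost]
      omega

end Realizes

namespace PolyTime
variable {L : α → List β} {I : α → γ} {f : α × β × γ → γ}

theorem polyBounded_iterTime {T : α × β × γ → ℕ} (hT : PolyBounded T)
    (hL : PolyTime L) {B : α → ℕ} (hB : PolyBounded B) :
    ∃ N : α → ℕ, PolyBounded N ∧ ∀ x l₁ b l₂ c, L x = l₁ ++ b :: l₂ → encSize c ≤ B x →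
      encSize (f (x, b, c)) ≤ B x → iterTime f T x b l₂ c ≤ N x := by
  obtain ⟨C, hC, hTC⟩ := hT.exists_bound_of_encSize_le
    (((PolyBounded.encSize_self.add hL.polyBounded).add hB).add (.const 2))
  refine ⟨fun x => C x + 7 * (encSize x + encSize (L x) + B x + B x + 1),
    hC.add ((PolyBounded.const 7).mul ((((PolyBounded.encSize_self.add hL.polyBounded).add hB).add
      hB).add (.const 1))), fun x l₁ b l₂ c hl hc hf => ?_⟩
  have hsub : encSize (b :: l₂) ≤ encSize (L x) :=
    encSize_le_of_sublist (hl ▸ List.sublist_append_right _ _)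
  have hTime : T (x, b, c) ≤ C x := hTC x _ (by
    rw [encSize_cons] at hsub
    simp only [encSize_prod]
    omega)
  simp only [iterTime]
  omega

theorem foldl (hL : PolyTime L) (hI : PolyTime I) (hf : PolyTime f)
    (hB : ∃ B : α → ℕ, PolyBounded B ∧ ∀ x l₁ l₂, L x = l₁ ++ l₂ →
      encSize (l₁.foldl (fun c b => f (x, b, c)) (I x)) ≤ B x) :
    PolyTime fun x => (L x).foldl (fun c b => f (x, b, c)) (I x) := by
  obtain ⟨B, hBpoly, hB⟩ := hB
  have hLsize := hL.polyBounded
  obtain ⟨T, hT, hf⟩ := hf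
  obtain ⟨N, hN, hiter⟩ := polyBounded_iterTime (f := f) hT hL hBpoly
  obtain ⟨R, hR, hL⟩ := hL
  obtain ⟨S, hS, hI⟩ := hI
  refine ⟨fun x => encSize x + 1 + R x + (encSize x + 1 + S x + (encSize (L x) * N x + 2 +
      (B x + 1))),
    ((PolyBounded.encSize_self.add (.const 1)).add hR).add
      (((PolyBounded.encSize_self.add (.const 1)).add hS).add
        (((hLsize.mul hN).add (.const 2)).add (hBpoly.add (.const 1)))), fun i => ?_⟩
  obtain ⟨r, hr⟩ := hL (i + 1)
  obtain ⟨s, hs⟩ := hI (i + 2)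
  obtain ⟨p, hp⟩ := hf (i + 3)
  refine ⟨.seq (copyThen i (i + 1) r) (.seq (copyThen i (i + 2) s)
    (.seq (foldLoop i p) (.assign i (.reg (i + 2))))), fun σ x hx => ?_⟩
  obtain ⟨σ₁, hexec₁, hval₁, hold₁⟩ := hr.exec_copyThen hx
  have hx₁ : σ₁ i = enc x := (hold₁ i (by omega)).trans hx
  obtain ⟨σ₂, hexec₂, hval₂, hold₂⟩ := hs.exec_copyThen hx₁
  obtain ⟨σ₃, hexec₃, hval₃, hold₃⟩ := hp.exec_foldLoop
    ⟨(hold₂ i (by omega)).trans hx₁, (hold₂ _ (by omega)).trans hval₁, hval₂⟩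
    fun l₁ b l₂ hl => hiter x l₁ b l₂ _ hl (hB x l₁ (b :: l₂) hl) (by
      simpa using hB x (l₁ ++ [b]) l₂ (by simp [hl]))
  refine ⟨_, hexec₁.seq (hexec₂.seq ((hexec₃.mono ?_).seq (.assign hval₃ ?_))),
    Function.update_self .., fun j hj => ?_⟩
  · exact Nat.add_le_add_right (Nat.mul_le_mul_right _ (length_lt_encSize _).le) 2
  · simp only [Expr.cost, hval₃]
    exact Nat.lt_succ_of_le (hB x (L x) [] (by simp))
  · rw [Function.update_of_ne hj.ne, hold₃ j hj, hold₂ j (by omega), hold₁ j (by omega)]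

theorem cons {f : α → β} {g : α → List β} (hf : PolyTime f) (hg : PolyTime g) :
    PolyTime fun a => f a :: g a :=
  of_enc_eq (toData.comp (hf.pair hg)) fun _ => rfl

theorem reverse {f : α → List β} (hf : PolyTime f) : PolyTime fun a => (f a).reverse := by
  suffices h : PolyTime fun l : List β => l.foldl (fun c b => b :: c) [] by
    simpa using h.comp hf
  refine foldl (f := fun y : List β × β × List β => y.2.1 :: y.2.2) id (const [])
    ((fst.comp snd).cons (snd.comp snd)) ⟨_, .encSize_self, fun l l₁ l₂ h => ?_⟩
  simpa [encSize_reverse] using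
    encSize_le_of_sublist (h ▸ List.sublist_append_left l₁ l₂ : l₁.Sublist l)

theorem foldr (hL : PolyTime L) (hI : PolyTime I) (hf : PolyTime f)
    (hB : ∃ B : α → ℕ, PolyBounded B ∧ ∀ x l₁ l₂, L x = l₁ ++ l₂ →
      encSize (l₂.foldr (fun b c => f (x, b, c)) (I x)) ≤ B x) :
    PolyTime fun x => (L x).foldr (fun b c => f (x, b, c)) (I x) := by
  obtain ⟨B, hB, hle⟩ := hB
  simpa only [List.foldl_reverse] using foldl hL.reverse hI hf ⟨B, hB, fun x l₁ l₂ h => by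
    rw [← List.foldr_reverse]
    exact hle x l₂.reverse l₁.reverse (by
      rw [← List.reverse_append, ← h, List.reverse_reverse])⟩

theorem foldr_of_encSize_le_add (hL : PolyTime L) (hI : PolyTime I) (hf : PolyTime f)
    (hB : ∃ B : α → ℕ, PolyBounded B ∧ ∀ x l₁ b l₂, L x = l₁ ++ b :: l₂ →
      encSize (f (x, b, l₂.foldr (fun b c => f (x, b, c)) (I x))) ≤
        encSize (l₂.foldr (fun b c => f (x, b, c)) (I x)) + B x) :
    PolyTime fun x => (L x).foldr (fun b c => f (x, b, c)) (I x) := by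
  obtain ⟨B, hB, hle⟩ := hB
  refine hL.foldr hI hf ⟨fun x => encSize (I x) + encSize (L x) * B x,
    hI.polyBounded.add (hL.polyBounded.mul hB), fun x l₁ l₂ hl => ?_⟩
  have hlen : l₂.length ≤ encSize (L x) := by
    have := length_lt_encSize (L x)
    rw [hl, List.length_append] at this
    rw [hl]
    omega
  refine le_trans ?_ (Nat.add_le_add_left (Nat.mul_le_mul_right _ hlen) _)
  clear hlen
  induction l₂ generalizing l₁ with
  | nil => simp
  | cons b l₂ ih =>
    have hrest := ih (l₁ ++ [b]) (by simp [hl])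
    have hstep := hle x l₁ b l₂ hl
    rw [List.foldr_cons, List.length_cons, add_mul]
    omega

end PolyTime
end

theorem length_foldr_append_le {β γ : Type} {g : β → ℕ → List γ} {w : ℕ}
    (hw : ∀ b n, (g b n).length ≤ w) (l : List β) (l₀ : List γ) :
    (l.foldr (fun b c => g b c.length ++ c) l₀).length ≤ l₀.length + l.length * w := by
  induction l with
  | nil => simp
  | cons b l ih =>
    have := hw b (l.foldr (fun b c => g b c.length ++ c) l₀).length
    rw [List.foldr_cons, List.length_append, List.length_cons, add_mul]
    omega

section
variable {α β γ : Type} [Enc α] [Enc β] [Enc γ]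

namespace PolyTime

theorem succ {f : α → ℕ} (hf : PolyTime f) : PolyTime fun a => f a + 1 :=
  of_enc_eq (toData.comp ((const ()).pair hf)) fun _ => rfl

theorem pred {f : α → ℕ} (hf : PolyTime f) : PolyTime fun a => f a - 1 :=
  of_enc_eq (tl.comp (toData.comp hf)) fun a => by cases f a <;> rfl

theorem add_const {f : α → ℕ} (hf : PolyTime f) (n : ℕ) : PolyTime fun a => f a + n := by
  induction n with
  | zero => exact hf
  | succ n ih => exact ih.succ

theorem sub_const {f : α → ℕ} (hf : PolyTime f) (n : ℕ) : PolyTime fun a => f a - n := by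
  induction n with
  | zero => exact hf
  | succ n ih => exact ih.pred

theorem append {f g : α → List β} (hf : PolyTime f) (hg : PolyTime g) :
    PolyTime fun a => f a ++ g a := by
  have h := foldr_of_encSize_le_add (f := fun y : α × β × List β => y.2.1 :: y.2.2) hf hg
    ((fst.comp snd).cons (snd.comp snd))
    ⟨_, hf.polyBounded, fun a l₁ b l₂ hl => by
      have := encSize_lt_of_mem (a := b) (l := f a) (by simp [hl])
      simp only [encSize_cons]
      omega⟩
  simpa using h

theorem length {f : α → List β} (hf : PolyTime f) : PolyTime fun a => (f a).length := by
  have h := foldr_of_encSize_le_add (f := fun y : α × β × ℕ => y.2.2 + 1) hf (const 0)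
    (snd.comp snd).succ ⟨_, .const 2, fun a l₁ b l₂ _ => by simp only [encSize_nat]; omega⟩
  convert h using 2 with a
  induction f a with
  | nil => rfl
  | cons b l ih => rw [List.length_cons, List.foldr_cons, ih]

theorem flatMap {f : α → List β} {g : α × β → List γ} (hf : PolyTime f) (hg : PolyTime g) :
    PolyTime fun a => (f a).flatMap fun b => g (a, b) := by
  obtain ⟨B, hB, hgB⟩ := hg.polyBounded.exists_bound_of_encSize_le
    ((PolyBounded.encSize_self.add hf.polyBounded).add (.const 1))
  have h := foldr_of_encSize_le_add (f := fun y : α × β × List γ => g (y.1, y.2.1) ++ y.2.2) hf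
    (const []) ((hg.comp (fst.pair (fst.comp snd))).append (snd.comp snd))
    ⟨B, hB, fun a l₁ b l₂ hl => by
      have hb := encSize_lt_of_mem (a := b) (l := f a) (by simp [hl])
      have hgb := hgB a (a, b) (by rw [encSize_prod]; omega)
      have happend := encSize_append (g (a, b))
        (l₂.foldr (fun b c => g (a, b) ++ c) [])
      simp only
      omega⟩
  convert h using 2 with a
  induction f a with
  | nil => rfl
  | cons b l ih => rw [List.flatMap_cons, List.foldr_cons, ih]

theorem decide_mem [DecidableEq β] (hinj : Function.Injective (enc : β → Data)) {f : α → β}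
    {g : α → List β} (hf : PolyTime f) (hg : PolyTime g) :
    PolyTime fun a => decide (f a ∈ g a) := by
  have h := foldr_of_encSize_le_add
    (f := fun y : α × β × Bool => if decide (f y.1 = y.2.1) then true else y.2.2) hg (const false)
    (ite (decide_eq hinj (hf.comp fst) (fst.comp snd)) (const true) (snd.comp snd))
    ⟨_, .const 3, fun a l₁ b l₂ _ => (encSize_bool_le _).trans (Nat.le_add_left _ _)⟩
  convert h using 2 with a
  induction g a with
  | nil => rfl
  | cons b l ih =>
    simp only [List.foldr_cons, ← ih, List.mem_cons]
    by_cases h : f a = b <;> simp [h]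

theorem dedup [DecidableEq β] (hinj : Function.Injective (enc : β → Data)) {f : α → List β}
    (hf : PolyTime f) : PolyTime fun a => (f a).dedup := by
  have h := foldr_of_encSize_le_add (I := fun _ => ([] : List β))
    (f := fun y : α × β × List β => if decide (y.2.1 ∈ y.2.2) then y.2.2 else y.2.1 :: y.2.2)
    hf (const []) (ite (decide_mem hinj (fst.comp snd) (snd.comp snd)) (snd.comp snd)
      ((fst.comp snd).cons (snd.comp snd)))
    ⟨_, hf.polyBounded, fun a l₁ b l₂ hl => by
      have := encSize_lt_of_mem (a := b) (l := f a) (by simp [hl])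
      simp only
      split_ifs
      · omega
      · rw [encSize_cons]; omega⟩
  convert h using 2 with a
  induction f a with
  | nil => rfl
  | cons b l ih =>
    rw [List.foldr_cons, ← ih]
    by_cases hb : b ∈ l <;> simp [hb]

theorem option_some {f : α → β} (hf : PolyTime f) : PolyTime fun a => some (f a) :=
  of_enc_eq (toData.comp (hf.cons (const []))) fun _ => rfl

theorem option_elim {o : α → Option β} {f : α → γ} {g : α × β → γ} (ho : PolyTime o)
    (hf : PolyTime f) (hg : PolyTime g) :
    PolyTime fun a => (o a).elim (f a) fun b => g (a, b) := by
  have htoList : PolyTime fun a => (o a).toList := of_enc_eq (toData.comp ho) fun _ => rfl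
  obtain ⟨B, hB, hgB⟩ := hg.polyBounded.exists_bound_of_encSize_le
    ((PolyBounded.encSize_self.add htoList.polyBounded).add (.const 1))
  have h := foldr_of_encSize_le_add (f := fun y : α × β × γ => g (y.1, y.2.1)) htoList hf
    (hg.comp (fst.pair (fst.comp snd)))
    ⟨B, hB, fun a l₁ b l₂ hl => by
      have hb := encSize_lt_of_mem (a := b) (l := (o a).toList) (by simp [hl])
      exact (hgB a (a, b) (by rw [encSize_prod]; omega)).trans (Nat.le_add_left _ _)⟩
  convert h using 2 with a
  cases o a <;> rfl

theorem list_map {ι : Type} (s : List ι) {f : ι → α → β} (hf : ∀ i, PolyTime (f i)) :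
    PolyTime fun a => s.map fun i => f i a := by
  induction s with
  | nil => exact const []
  | cons i s ih => exact (hf i).cons ih

theorem of_finite [Finite α] (hinj : Function.Injective (enc : α → Data)) [Inhabited γ]
    {f : α × β → γ} (hf : ∀ a, PolyTime fun b => f (a, b)) : PolyTime f := by
  classical
  have := Fintype.ofFinite α
  suffices key : ∀ s : Finset α, ∃ g : α × β → γ, PolyTime g ∧ ∀ x, x.1 ∈ s → g x = f x by
    obtain ⟨g, hg, hgf⟩ := key Finset.univ
    rwa [funext fun x => (hgf x (Finset.mem_univ _)).symm]
  intro s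
  induction s using Finset.induction_on with
  | empty => exact ⟨fun _ => default, const _, by simp⟩
  | insert a s _ ih =>
    obtain ⟨g, hg, hgf⟩ := ih
    refine ⟨fun x => if decide (x.1 = a) then f (a, x.2) else g x,
      ite (decide_eq hinj fst (const a)) ((hf a).comp snd) hg, fun x hx => ?_⟩
    by_cases hxa : x.1 = a
    · simp [← hxa]
    · simpa [hxa] using hgf x (by simpa [hxa] using hx)

end PolyTime

theorem PolyTime.foldr_append {L : α → List β} {I : α → List γ} {g : β × ℕ → List γ}
    (hL : PolyTime L) (hI : PolyTime I) (hg : PolyTime g) {w : ℕ} (hw : ∀ y, (g y).length ≤ w) :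
    PolyTime fun x => (L x).foldr (fun b c => g (b, c.length) ++ c) (I x) := by
  obtain ⟨B, hB, hgB⟩ := hg.polyBounded.exists_bound_of_encSize_le (hL.polyBounded.add
    (((PolyBounded.const 2).mul (hI.polyBounded.add (hL.polyBounded.mul (.const w)))).add
      (.const 2)))
  refine foldr_of_encSize_le_add (f := fun y : α × β × List γ => g (y.2.1, y.2.2.length) ++ y.2.2)
    hL hI ((hg.comp ((fst.comp snd).pair (length (snd.comp snd)))).append (snd.comp snd))
    ⟨B, hB, fun x l₁ b l₂ hl => ?_⟩
  have hb := encSize_lt_of_mem (a := b) (l := L x) (by simp [hl])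
  have hlen : l₂.length * w ≤ encSize (L x) * w := by
    have := length_lt_encSize (L x)
    rw [hl, List.length_append, List.length_cons] at this
    rw [hl]
    exact Nat.mul_le_mul_right _ (by omega)
  have hfold := length_foldr_append_le (fun b n => hw (b, n)) l₂ (I x)
  have hI := length_lt_encSize (I x)
  set c := l₂.foldr (fun b c => g (b, c.length) ++ c) (I x)
  have hstep := hgB x (b, c.length) (by rw [encSize_prod, encSize_nat]; omega)
  have happend := encSize_append (g (b, c.length)) c
  simp only
  omega

namespace PolyTime
variable {k : ℕ}

theorem node {f g : α → Data} (hf : PolyTime f) (hg : PolyTime g) :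
    PolyTime fun a => Data.node (f a) (g a) :=
  of_enc_eq (toData.comp (hf.pair hg)) fun _ => rfl

theorem gate_var {f : α → Fact k} (hf : PolyTime f) : PolyTime fun a => Gate.var (f a) :=
  of_enc_eq ((const (encNat 0)).node (toData.comp hf)) fun _ => rfl

theorem gate_not {f : α → ℕ} (hf : PolyTime f) :
    PolyTime fun a => (Gate.not (f a) : Gate (Fact k)) :=
  of_enc_eq ((const (encNat 1)).node (toData.comp hf)) fun _ => rfl

theorem gate_and {f : α → List ℕ} (hf : PolyTime f) :
    PolyTime fun a => (Gate.and (f a) : Gate (Fact k)) :=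
  of_enc_eq ((const (encNat 2)).node (toData.comp hf)) fun _ => rfl

theorem gate_or {f : α → List ℕ} (hf : PolyTime f) :
    PolyTime fun a => (Gate.or (f a) : Gate (Fact k)) :=
  of_enc_eq ((const (encNat 3)).node (toData.comp hf)) fun _ => rfl

end PolyTime
end

/-! ### Building d-Ds gate by gate -/

namespace Circuit
variable {X : Type} {V W W' : Set X} {c c' : Circuit X} {f f' : Set X → Prop} {i j m : ℕ}

theorem value_append (ν : Set X) (gs : Circuit X) (hi : i < c.length) :
    value ν (gs ++ c) i = value ν c i := by
  induction gs with
  | nil => rfl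
  | cons g gs ih =>
    have hne : i ≠ (gs ++ c).length := by rw [List.length_append]; omega
    rw [List.cons_append, ← ih]
    cases g <;> simp only [value, if_neg hne]

theorem vars_append (gs : Circuit X) (hi : i < c.length) : vars (gs ++ c) i = vars c i := by
  induction gs with
  | nil => rfl
  | cons g gs ih =>
    have hne : i ≠ (gs ++ c).length := by rw [List.length_append]; omega
    rw [List.cons_append, ← ih]
    cases g <;> simp only [vars, if_neg hne]

/-- The conditions under which a d-D over the variables `V` remains one when the gate `g` is put on
top of it. -/
def GateAdmissible (V : Set X) (c : Circuit X) (g : Gate X) : Prop :=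
  (∀ i ∈ g.inputs, i < c.length) ∧
    match g with
    | .var x => x ∈ V
    | .not _ => True
    | .and is => is.Pairwise fun i j => Disjoint (vars c i) (vars c j)
    | .or is => is.Pairwise fun i j => ∀ ν : Set X, ¬ (value ν c i ∧ value ν c j)

/-- `c` is empty or a d-D over the variables `V`. -/
def Admissible (V : Set X) (c : Circuit X) : Prop :=
  ∀ g rest, (g :: rest) <:+ c → GateAdmissible V rest g

theorem admissible_nil : Admissible V ([] : Circuit X) := fun _ _ h => by simp at h

theorem Admissible.cons {g : Gate X} (hc : Admissible V c) (hg : GateAdmissible V c g) :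
    Admissible V (g :: c) := by
  intro g' rest h
  rcases List.suffix_cons_iff.1 h with h | h
  · obtain ⟨rfl, rfl⟩ := List.cons.inj h
    exact hg
  · exact hc g' rest h

theorem Admissible.isDD (hc : Admissible V c) (hne : c ≠ []) : c.IsDD V := by
  refine ⟨⟨hne, fun g rest h => (hc g rest h).1, fun x hx => ?_⟩,
    fun is rest h => (hc _ rest h).2, fun is rest h => (hc _ rest h).2⟩
  obtain ⟨s, t, rfl⟩ := List.append_of_mem hx
  exact (hc _ t (List.suffix_append s _)).2

/-- Gate number `i` of `c` captures the Boolean function `f` and depends only on variables in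
`W`. -/
structure Captures (c : Circuit X) (i : ℕ) (f : Set X → Prop) (W : Set X) : Prop where
  lt : i < c.length
  value_iff : ∀ ν, c.value ν i ↔ f ν
  vars_subset : c.vars i ⊆ W

namespace Captures

theorem of_suffix (h : Captures c i f W) (hc : c <:+ c') : Captures c' i f W := by
  obtain ⟨gs, rfl⟩ := hc
  refine ⟨h.lt.trans_le (by simp), fun ν => ?_, ?_⟩
  · rw [value_append ν gs h.lt, h.value_iff]
  · rw [vars_append gs h.lt]
    exact h.vars_subset

theorem mono_vars (h : Captures c i f W) (hW : W ⊆ W') : Captures c i f W' :=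
  ⟨h.lt, h.value_iff, h.vars_subset.trans hW⟩

theorem congr (h : Captures c i f W) (hf : ∀ ν, f ν ↔ f' ν) : Captures c i f' W :=
  ⟨h.lt, fun ν => (h.value_iff ν).trans (hf ν), h.vars_subset⟩

end Captures

/-- The gate `g` may be put on top of the d-D `c` over `V`, and there it captures the Boolean
function `f` and depends only on variables in `W`. -/
structure GateCaptures (V : Set X) (c : Circuit X) (g : Gate X) (f : Set X → Prop)
    (W : Set X) : Prop where
  admissible : GateAdmissible V c g
  captures : Captures (g :: c) c.length f W

namespace GateCaptures

theorem of_var {x : X} (hx : x ∈ V) : GateCaptures V c (.var x) (fun ν => x ∈ ν) {x} :=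
  ⟨by simp [GateAdmissible, Gate.inputs, hx], by simp, by simp [value], by simp [vars]⟩

theorem of_not (h : Captures c i f W) : GateCaptures V c (.not i) (fun ν => ¬ f ν) W :=
  ⟨by simpa [GateAdmissible, Gate.inputs] using h.lt, by simp, by simp [value, h.value_iff],
    by simpa [vars] using h.vars_subset⟩

theorem of_and (h : Captures c i f W) (h' : Captures c j f' W') (hW : Disjoint W W') :
    GateCaptures V c (.and [i, j]) (fun ν => f ν ∧ f' ν) (W ∪ W') :=
  ⟨by simpa [GateAdmissible, Gate.inputs, h.lt, h'.lt]
      using hW.mono h.vars_subset h'.vars_subset,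
    by simp, by simp [value, h.value_iff, h'.value_iff],
    by simpa [vars] using Set.union_subset_union h.vars_subset h'.vars_subset⟩

theorem of_or (h : Captures c i f W) (h' : Captures c j f' W') (hf : ∀ ν, ¬ (f ν ∧ f' ν)) :
    GateCaptures V c (.or [i, j]) (fun ν => f ν ∨ f' ν) (W ∪ W') :=
  ⟨by simpa [GateAdmissible, Gate.inputs, h.lt, h'.lt, h.value_iff, h'.value_iff] using hf,
    by simp, by simp [value, h.value_iff, h'.value_iff],
    by simpa [vars] using Set.union_subset_union h.vars_subset h'.vars_subset⟩

theorem of_copy (h : Captures c i f W) : GateCaptures V c (.or [i]) f W :=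
  ⟨by simpa [GateAdmissible, Gate.inputs] using h.lt, by simp, by simp [value, h.value_iff],
    by simpa [vars] using h.vars_subset⟩

theorem of_const (p : Prop) [Decidable p] :
    GateCaptures V c (if p then .and [] else .or []) (fun _ => p) ∅ := by
  split_ifs with hp
  · exact ⟨by simp [GateAdmissible, Gate.inputs], by simp, by simp [value, hp], by simp [vars]⟩
  · exact ⟨by simp [GateAdmissible, Gate.inputs], by simp, by simp [value, hp], by simp [vars]⟩

end GateCaptures

/-! ### Layers of gates for the states of an automaton -/

/-- The gates `g 0, …, g (m - 1)`, to be put on top of a circuit `c`; the gate `g q` then has the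
number `c.length + q`. -/
def layer (g : Fin m → Gate X) : Circuit X := (List.finRange m).reverse.map g

theorem length_layer (g : Fin m → Gate X) : (layer g).length = m := by simp [layer]

theorem layer_succ (g : Fin (m + 1) → Gate X) :
    layer g = g (Fin.last m) :: layer fun q => g q.castSucc := by
  simp [layer, List.finRange_succ_last, Function.comp_def]

theorem Admissible.append_layer {f : Fin m → Set X → Prop} (hc : Admissible V c)
    {g : Fin m → Gate X} (hg : ∀ q c', c <:+ c' → GateCaptures V c' (g q) (f q) W) :
    Admissible V (layer g ++ c) ∧ ∀ q : Fin m, Captures (layer g ++ c) (c.length + q) (f q) W := by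
  induction m with
  | zero => exact ⟨by simpa [layer] using hc, fun q => q.elim0⟩
  | succ m ih =>
    obtain ⟨hadm, hcap⟩ := ih (f := fun q => f q.castSucc) fun q => hg q.castSucc
    have hlast := hg (Fin.last m) _ (List.suffix_append (layer fun q => g q.castSucc) c)
    rw [layer_succ, List.cons_append]
    refine ⟨hadm.cons hlast.admissible, fun q => Fin.lastCases ?_ (fun q => ?_) q⟩
    · simpa [length_layer, add_comm] using hlast.captures
    · exact (hcap q).of_suffix (List.suffix_cons _ _)

/-- `c` is a d-D over `V` whose last `m` gates capture the Boolean functions `f` and depend only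
on variables in `W`. -/
structure TopLayer (V : Set X) (c : Circuit X) (f : Fin m → Set X → Prop) (W : Set X) : Prop where
  admissible : Admissible V c
  captures : ∀ q : Fin m, Captures c (c.length - m + q) (f q) W

theorem Admissible.topLayer {f : Fin m → Set X → Prop} (hc : Admissible V c) {g : Fin m → Gate X}
    (hg : ∀ q c', c <:+ c' → GateCaptures V c' (g q) (f q) W) : TopLayer V (layer g ++ c) f W := by
  obtain ⟨hadm, hcap⟩ := hc.append_layer hg
  exact ⟨hadm, by simpa [length_layer] using hcap⟩

variable {A : Type}

/-- The gates for the acceptance condition `acc` of an automaton. -/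
def acceptGates (acc : Fin m → Bool) : Circuit X := layer fun q => if acc q then .and [] else .or []

theorem Admissible.topLayer_acceptGates (hc : Admissible V c) (acc : Fin m → Bool) :
    TopLayer V (acceptGates acc ++ c) (fun q _ => acc q = true) ∅ :=
  hc.topLayer fun _ _ _ => .of_const _

/-- The gates for one step of an automaton with the transition function `δ`, on top of `N` gates of
which the last `m` belong to the states after the step. An item consists of a letter and possibly a
variable whose value is read; without a variable, the value false is read. -/
def stepGates (δ : A → Fin m → Bool → Fin m) (y : A × Option X) (N : ℕ) : Circuit X :=
  y.2.elim (layer fun q => .or [N - m + δ y.1 q false]) fun x =>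
    layer (fun q : Fin m => .or [N + 2 + q, N + 2 + m + q]) ++
    (layer (fun q => .and [N + 1, N - m + δ y.1 q false]) ++
    (layer (fun q => .and [N, N - m + δ y.1 q true]) ++ [.not N, .var x]))

theorem length_stepGates_le (δ : A → Fin m → Bool → Fin m) (y : A × Option X) (N : ℕ) :
    (stepGates δ y N).length ≤ 3 * m + 2 := by
  obtain ⟨a, _ | x⟩ := y <;>
    simp only [stepGates, Option.elim, List.length_append, length_layer, List.length_cons,
      List.length_nil] <;>
    omega

namespace TopLayer
variable {f : Fin m → Set X → Prop}

theorem step_none (hc : TopLayer V c f W) (δ : A → Fin m → Bool → Fin m) (a : A) :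
    TopLayer V (stepGates δ (a, none) c.length ++ c) (fun q => f (δ a q false)) W :=
  hc.admissible.topLayer fun q _ hc' => .of_copy ((hc.captures (δ a q false)).of_suffix hc')

open Classical in
theorem step_some (hc : TopLayer V c f W) (δ : A → Fin m → Bool → Fin m) (a : A) {x : X}
    (hx : x ∈ V) (hxW : x ∉ W) :
    TopLayer V (stepGates δ (a, some x) c.length ++ c) (fun q ν => f (δ a q (decide (x ∈ ν))) ν)
      (insert x W) := by
  have hdisj : Disjoint {x} W := Set.disjoint_singleton_left.2 hxW
  have hvar : GateCaptures V c (.var x) (fun ν => x ∈ ν) {x} := .of_var hx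
  have hnot : GateCaptures V (.var x :: c) (.not c.length) (fun ν => x ∉ ν) {x} :=
    .of_not hvar.captures
  set c₀ : Circuit X := .not c.length :: .var x :: c with hc₀
  have hsuffix : c <:+ c₀ := (List.suffix_cons _ _).trans (List.suffix_cons _ _)
  obtain ⟨hadm₁, htrue⟩ := ((hc.admissible.cons hvar.admissible).cons hnot.admissible).append_layer
    fun q c' hc' => .of_and ((hvar.captures.of_suffix (List.suffix_cons _ _)).of_suffix hc')
      ((hc.captures (δ a q true)).of_suffix (hsuffix.trans hc')) hdisj
  set c₁ := layer (fun q => .and [c.length, c.length - m + δ a q true]) ++ c₀ with hc₁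
  have hsuffix₁ : c₀ <:+ c₁ := List.suffix_append _ _
  obtain ⟨hadm₂, hfalse⟩ := hadm₁.append_layer fun q c' hc' =>
    .of_and (hnot.captures.of_suffix (hsuffix₁.trans hc'))
      ((hc.captures (δ a q false)).of_suffix (hsuffix.trans (hsuffix₁.trans hc'))) hdisj
  have hor := hadm₂.topLayer fun (q : Fin m) c' hc' =>
    .of_or ((htrue q).of_suffix ((List.suffix_append _ c₁).trans hc'))
      ((hfalse q).of_suffix hc') fun ν h => h.2.1 h.1.1
  convert hor using 1
  · simp [stepGates, hc₁, hc₀, length_layer, add_comm, add_left_comm]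
  · ext q ν
    by_cases h : x ∈ ν <;> simp [h]
  · rw [Set.union_self, Set.insert_eq]

end TopLayer

open Classical in
/-- The state of an automaton after it has read a list of items. -/
noncomputable def run {S : Type} (δ : A → S → Bool → S) (ν : Set X) (s : S)
    (ys : List (A × Option X)) : S :=
  ys.foldl (fun s y => δ y.1 s (y.2.any fun x => decide (x ∈ ν))) s

theorem run_equiv {S T : Type} (e : S ≃ T) (δ : A → S → Bool → S) (ν : Set X) (s : S)
    (ys : List (A × Option X)) :
    run (fun a t b => e (δ a (e.symm t) b)) ν (e s) ys = e (run δ ν s ys) :=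
  List.foldl_hom e fun s y => by simp only [e.symm_apply_apply]

/-- The variables whose values are read, in the order in which they are read. -/
def readVars (ys : List (A × Option X)) : List X := ys.filterMap Prod.snd

/-- The circuit, on top of `c`, for an automaton that reads the items `ys`. It is built from the
last item to the first. -/
def runCircuit (δ : A → Fin m → Bool → Fin m) (acc : Fin m → Bool) (ys : List (A × Option X))
    (c : Circuit X) : Circuit X :=
  ys.foldr (fun y c => stepGates δ y c.length ++ c) (acceptGates acc ++ c)

theorem suffix_runCircuit (δ : A → Fin m → Bool → Fin m) (acc : Fin m → Bool)
    (ys : List (A × Option X)) (c : Circuit X) : c <:+ runCircuit δ acc ys c := by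
  induction ys with
  | nil => exact List.suffix_append _ _
  | cons y ys ih => exact ih.trans (List.suffix_append _ _)

theorem Admissible.topLayer_runCircuit (hc : Admissible V c) (δ : A → Fin m → Bool → Fin m)
    (acc : Fin m → Bool) (ys : List (A × Option X)) (hV : ∀ x ∈ readVars ys, x ∈ V)
    (hys : (readVars ys).Nodup) :
    TopLayer V (runCircuit δ acc ys c) (fun q ν => acc (run δ ν q ys) = true)
      {x | x ∈ readVars ys} := by
  induction ys with
  | nil => simpa [runCircuit, run, readVars] using hc.topLayer_acceptGates acc
  | cons y ys ih =>
    obtain ⟨a, _ | x⟩ := y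
    · simpa [runCircuit, run, readVars] using (ih hV hys).step_none δ a
    · have hread : readVars ((a, some x) :: ys) = x :: readVars ys := rfl
      simp only [hread, List.nodup_cons, List.forall_mem_cons] at hV hys
      have hinsert : {z | z ∈ readVars ((a, some x) :: ys)} = insert x {z | z ∈ readVars ys} := by
        ext z
        simp [hread]
      rw [hinsert]
      simpa [runCircuit, run] using (ih hV.2 hys.2).step_some δ a hV.1 hys.1

end Circuit
open Circuit

/-! ### Queries whose lineages are built in polynomial time -/

section
variable {α A : Type} [Enc α] [Enc A] [Finite A] {k m : ℕ}

theorem PolyTime.layer {g : α → Fin m → Gate (Fact k)} (hg : ∀ q, PolyTime fun a => g a q) :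
    PolyTime fun a => layer (g a) :=
  list_map _ hg

theorem PolyTime.stepGates (hinj : Function.Injective (enc : A → Data))
    (δ : A → Fin m → Bool → Fin m) :
    PolyTime fun y : (A × Option (Fact k)) × ℕ => stepGates δ y.1 y.2 := by
  suffices h : PolyTime fun y : A × Option (Fact k) × ℕ =>
      Circuit.stepGates δ (y.1, y.2.1) y.2.2 from
    h.comp ((fst.comp fst).pair ((snd.comp fst).pair snd))
  refine of_finite hinj fun a => ?_
  have hN : PolyTime fun y : Option (Fact k) × ℕ => y.2 := snd
  refine option_elim (g := fun z : (Option (Fact k) × ℕ) × Fact k =>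
      Circuit.layer (fun q : Fin m => .or [z.1.2 + 2 + q, z.1.2 + 2 + m + q]) ++
      (Circuit.layer (fun q => .and [z.1.2 + 1, z.1.2 - m + δ a q false]) ++
      (Circuit.layer (fun q => .and [z.1.2, z.1.2 - m + δ a q true]) ++ [.not z.1.2, .var z.2])))
    fst (layer fun q => gate_or (((hN.sub_const m).add_const (δ a q false)).cons (const []))) ?_
  have hN : PolyTime fun z : (Option (Fact k) × ℕ) × Fact k => z.1.2 := snd.comp fst
  have hor (q : Fin m) := ((hN.add_const 2).add_const q).cons
    ((((hN.add_const 2).add_const m).add_const q).cons (const []))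
  have hfalse (q : Fin m) :=
    (hN.add_const 1).cons (((hN.sub_const m).add_const (δ a q false)).cons (const []))
  have htrue (q : Fin m) := hN.cons (((hN.sub_const m).add_const (δ a q true)).cons (const []))
  exact (layer fun q => gate_or (hor q)).append ((layer fun q => gate_and (hfalse q)).append
    ((layer fun q => gate_and (htrue q)).append
      ((gate_not hN).cons ((gate_var snd).cons (const [])))))

theorem PolyTime.runCircuit (hinj : Function.Injective (enc : A → Data))
    (δ : A → Fin m → Bool → Fin m) (acc : Fin m → Bool)
    {items : List (Fact k) → List (A × Option (Fact k))} (hitems : PolyTime items) :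
    PolyTime fun x : List (Fact k) × Circuit (Fact k) =>
      runCircuit δ acc (items x.1) x.2 :=
  foldr_append (hitems.comp fst) ((const (acceptGates acc)).append snd)
    (.stepGates hinj δ) fun y => length_stepGates_le δ y.1 y.2

end

open Classical in
/-- The sub-database of those facts of `l` that are true under the valuation `ν`. -/
noncomputable def restrict {k : ℕ} (l : List (Fact k)) (ν : Set (Fact k)) : Database k :=
  l.toFinset.filter (· ∈ ν)

theorem mem_restrict {k : ℕ} {l : List (Fact k)} {ν : Set (Fact k)} {x : Fact k} :
    x ∈ restrict l ν ↔ x ∈ l ∧ x ∈ ν := by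
  simp [restrict]

theorem restrict_eq_self {k : ℕ} {l : List (Fact k)} {D : Database k} (hD : D ⊆ l.toFinset) :
    restrict l (D : Set (Fact k)) = D := by
  ext x
  simpa [mem_restrict] using fun hx => List.mem_toFinset.1 (hD hx)

/-- A polynomial-time function puts gates on top of any d-D over the facts of a database such that
the new output gate captures the lineage of `Q` and depends only on facts in `U`. Starting from an
arbitrary d-D makes it possible to combine several queries in one circuit. -/
def Buildable {k : ℕ} (U : Set (Fact k)) (Q : Query k) : Prop :=
  ∃ f : List (Fact k) × Circuit (Fact k) → Circuit (Fact k), PolyTime f ∧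
    ∀ (l : List (Fact k)) (c : Circuit (Fact k)), Admissible {x | x ∈ l} c →
      c <:+ f (l, c) ∧ Admissible {x | x ∈ l} (f (l, c)) ∧
      Captures (f (l, c)) ((f (l, c)).length - 1) (fun ν => Q (restrict l ν)) U

namespace Buildable
variable {k : ℕ} {U U' : Set (Fact k)} {Q Q' : Query k}

theorem congr (h : Buildable U Q) (hQ : ∀ D, Q D ↔ Q' D) : Buildable U Q' := by
  rwa [← funext fun D => propext (hQ D)]

theorem mono (h : Buildable U Q) (hU : U ⊆ U') : Buildable U' Q :=
  let ⟨f, hf, hc⟩ := h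
  ⟨f, hf, fun l c hl => (hc l c hl).imp_right (And.imp_right fun hcap => hcap.mono_vars hU)⟩

theorem of_gate {f : List (Fact k) × Circuit (Fact k) → Circuit (Fact k)}
    {g : List (Fact k) × Circuit (Fact k) → Gate (Fact k)} (hf : PolyTime f) (hg : PolyTime g)
    (h : ∀ l c, Admissible {x | x ∈ l} c → c <:+ f (l, c) ∧ Admissible {x | x ∈ l} (f (l, c)) ∧
      GateCaptures {x | x ∈ l} (f (l, c)) (g (l, c)) (fun ν => Q (restrict l ν)) U) :
    Buildable U Q := by
  refine ⟨fun x => g x :: f x, hg.cons hf, fun l c hc => ?_⟩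
  obtain ⟨hsuffix, hadm, hcap⟩ := h l c hc
  exact ⟨hsuffix.trans (List.suffix_cons _ _), hadm.cons hcap.admissible, hcap.captures⟩

theorem const_false : Buildable (∅ : Set (Fact k)) fun _ => False :=
  of_gate PolyTime.snd (.const _) fun _ _ hc => ⟨List.suffix_rfl, hc, .of_const False⟩

theorem not (h : Buildable U Q) : Buildable U fun D => ¬ Q D := by
  obtain ⟨f, hf, h⟩ := h
  refine of_gate hf (.gate_not (hf.length.sub_const 1)) fun l c hc => ?_
  obtain ⟨hsuffix, hadm, hcap⟩ := h l c hc
  exact ⟨hsuffix, hadm, .of_not hcap⟩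

theorem exists_both (h : Buildable U Q) (h' : Buildable U' Q') :
    ∃ f f' : List (Fact k) × Circuit (Fact k) → Circuit (Fact k), PolyTime f ∧ PolyTime f' ∧
      ∀ (l : List (Fact k)) (c : Circuit (Fact k)), Admissible {x | x ∈ l} c →
        c <:+ f' (l, c) ∧ Admissible {x | x ∈ l} (f' (l, c)) ∧
        Captures (f' (l, c)) ((f (l, c)).length - 1) (fun ν => Q (restrict l ν)) U ∧
        Captures (f' (l, c)) ((f' (l, c)).length - 1) (fun ν => Q' (restrict l ν)) U' := by
  obtain ⟨f, hf, h⟩ := h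
  obtain ⟨f', hf', h'⟩ := h'
  refine ⟨f, fun x => f' (x.1, f x), hf, hf'.comp (PolyTime.fst.pair hf), fun l c hc => ?_⟩
  obtain ⟨hsuffix, hadm, hcap⟩ := h l c hc
  obtain ⟨hsuffix', hadm', hcap'⟩ := h' l (f (l, c)) hadm
  exact ⟨hsuffix.trans hsuffix', hadm', hcap.of_suffix hsuffix', hcap'⟩

theorem and (h : Buildable U Q) (h' : Buildable U' Q') (hU : Disjoint U U') :
    Buildable (U ∪ U') fun D => Q D ∧ Q' D := by
  obtain ⟨f, f', hf, hf', H⟩ := h.exists_both h'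
  refine of_gate hf' (.gate_and ((hf.length.sub_const 1).cons
    ((hf'.length.sub_const 1).cons (.const [])))) fun l c hc => ?_
  obtain ⟨hsuffix, hadm, hcap, hcap'⟩ := H l c hc
  exact ⟨hsuffix, hadm, .of_and hcap hcap' hU⟩

theorem or (h : Buildable U Q) (h' : Buildable U' Q') (hQ : ∀ D, ¬ (Q D ∧ Q' D)) :
    Buildable (U ∪ U') fun D => Q D ∨ Q' D := by
  obtain ⟨f, f', hf, hf', H⟩ := h.exists_both h'
  refine of_gate hf' (.gate_or ((hf.length.sub_const 1).cons
    ((hf'.length.sub_const 1).cons (.const [])))) fun l c hc => ?_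
  obtain ⟨hsuffix, hadm, hcap, hcap'⟩ := H l c hc
  exact ⟨hsuffix, hadm, .of_or hcap hcap' fun ν => hQ _⟩

theorem inDDPTIME (h : Buildable U Q) : InDDPTIME Q := by
  obtain ⟨f, hf, h⟩ := h
  obtain ⟨p, P, hp⟩ := (hf.comp (PolyTime.id.pair (.const []))).exists_computes
  refine ⟨p, P, fun l => ?_⟩
  obtain ⟨t, hcomp, ht⟩ := hp l
  obtain ⟨-, hadm, hcap⟩ := h l [] admissible_nil
  refine ⟨f (l, []), t, hcomp, ht, ?_, fun D' hD' => (hcap.value_iff D').trans ?_⟩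
  · rw [List.coe_toFinset]
    exact hadm.isDD (List.ne_nil_of_length_pos (Nat.zero_lt_of_lt hcap.lt))
  · rw [restrict_eq_self hD']

theorem of_automaton {A S : Type} [Enc A] [Finite A] [Finite S]
    (hinj : Function.Injective (enc : A → Data)) (δ : A → S → Bool → S) (acc : S → Prop) (s₀ : S)
    {items : List (Fact k) → List (A × Option (Fact k))} (hitems : PolyTime items)
    (hmem : ∀ l, ∀ x ∈ readVars (items l), x ∈ l ∧ x ∈ U) (hnodup : ∀ l, (readVars (items l)).Nodup)
    (hQ : ∀ l ν, acc (run δ ν s₀ (items l)) ↔ Q (restrict l ν)) : Buildable U Q := by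
  classical
  obtain ⟨m, ⟨e⟩⟩ := Finite.exists_equiv_fin S
  set δ' : A → Fin m → Bool → Fin m := fun a q b => e (δ a (e.symm q) b) with hδ'
  set acc' : Fin m → Bool := fun q => decide (acc (e.symm q)) with hacc'
  have hf := PolyTime.runCircuit hinj δ' acc' hitems
  refine of_gate hf (.gate_or (((hf.length.sub_const m).add_const (e s₀)).cons (.const [])))
    fun l c hc => ?_
  have htop := hc.topLayer_runCircuit δ' acc' (items l) (fun x hx => (hmem l x hx).1) (hnodup l)
  refine ⟨suffix_runCircuit _ _ _ _, htop.admissible, .of_copy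
    (((htop.captures (e s₀)).mono_vars fun x hx => (hmem l x hx).2).congr fun ν => ?_)⟩
  rw [hδ', run_equiv, ← hQ l ν, hacc', decide_eq_true_iff, e.symm_apply_apply]

end Buildable

/-! ### Scanning a hierarchical family of atoms -/

section
variable {k : ℕ}

/-- The constants of a fact. -/
def Fact.consts : Fact k → List Const
  | .R a => [a]
  | .S _ a b => [a, b]
  | .T b => [b]

theorem polyTime_consts : PolyTime (Fact.consts : Fact k → List Const) := by
  have hrel : PolyTime fun x : Fact k => match x with
      | .R _ => 0 | .S j _ _ => (j : ℕ) + 1 | .T _ => k + 1 :=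
    .of_enc_eq (PolyTime.hd.comp .toData) fun x => by cases x <;> rfl
  have harg : PolyTime fun x : Fact k => (enc x).tl := PolyTime.tl.comp .toData
  refine .of_enc_eq
    (.ite (.decide_eq encNat_injective hrel (.const 0)) (harg.node (.const .nil))
      (.ite (.decide_eq encNat_injective hrel (.const (k + 1))) (harg.node (.const .nil))
        ((PolyTime.hd.comp harg).node ((PolyTime.tl.comp harg).node (.const .nil))))) fun x => ?_
  cases x with
  | R a => rfl
  | S j a b => simp [j.isLt.ne]; rfl
  | T b => simp; rfl

/-- The constants of a database. -/
def constList (l : List (Fact k)) : List Const := (l.flatMap Fact.consts).dedup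

theorem polyTime_constList : PolyTime (constList : List (Fact k) → List Const) :=
  .dedup encConst_injective (PolyTime.id.flatMap (polyTime_consts.comp .snd))

theorem nodup_constList (l : List (Fact k)) : (constList l).Nodup := List.nodup_dedup _

theorem mem_constList {l : List (Fact k)} {x : Fact k} (hx : x ∈ l) {a : Const}
    (ha : a ∈ x.consts) : a ∈ constList l :=
  List.mem_dedup.2 (List.mem_flatMap.2 ⟨x, hx, ha⟩)

end

section
variable {k : ℕ} {ι : Type}

/-- The atoms `f i u v` with `i ∈ root :: rest` are hierarchical: the atom `f root u v` only depends
on `u`, the other ones determine `u` and `v`, and different indices give different facts. -/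
structure IsHierarchical (f : ι → Const → Const → Fact k) (root : ι) (rest : List ι) : Prop where
  nodup : (root :: rest).Nodup
  root_eq : ∀ u v v', f root u v = f root u v'
  inj : ∀ i ∈ root :: rest, ∀ j ∈ root :: rest, ∀ u v u' v', f i u v = f j u' v' →
    i = j ∧ u = u' ∧ (i ≠ root → v = v')

/-- The facts `f i u v` for `i ∈ root :: rest` and constants `u, v` in `cs`, in an order in which
all facts with the same `u` are consecutive. -/
def instances (f : ι → Const → Const → Fact k) (root : ι) (rest : List ι) (cs : List Const) :
    List (Fact k) :=
  cs.flatMap fun u => f root u u :: cs.flatMap fun v => rest.map fun i => f i u v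

theorem mem_instances {f : ι → Const → Const → Fact k} {root : ι} {rest : List ι}
    {cs : List Const} {x : Fact k} (hx : x ∈ instances f root rest cs) :
    ∃ i ∈ root :: rest, ∃ u v, x = f i u v := by
  simp only [instances, List.mem_flatMap, List.mem_cons, List.mem_map] at hx
  obtain ⟨u, -, rfl | ⟨v, -, i, hi, rfl⟩⟩ := hx
  · exact ⟨root, List.mem_cons_self, u, u, rfl⟩
  · exact ⟨i, List.mem_cons_of_mem _ hi, u, v, rfl⟩

theorem IsHierarchical.nodup_instances {f : ι → Const → Const → Fact k} {root : ι} {rest : List ι}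
    (hf : IsHierarchical f root rest) {cs : List Const} (hcs : cs.Nodup) :
    (instances f root rest cs).Nodup := by
  obtain ⟨hroot, hrest⟩ := List.nodup_cons.1 hf.nodup
  have hinj : ∀ i ∈ rest, ∀ j ∈ rest, ∀ u v u' v', f i u v = f j u' v' →
      i = j ∧ u = u' ∧ v = v' := fun i hi j hj u v u' v' h => by
    obtain ⟨hij, hu, hv⟩ :=
      hf.inj i (List.mem_cons_of_mem _ hi) j (List.mem_cons_of_mem _ hj) _ _ _ _ h
    exact ⟨hij, hu, hv fun e => hroot (e ▸ hi)⟩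
  refine List.nodup_flatMap.2 ⟨fun u _ => List.nodup_cons.2 ⟨fun h => ?_, ?_⟩, ?_⟩
  · simp only [List.mem_flatMap, List.mem_map] at h
    obtain ⟨v, -, i, hi, h⟩ := h
    exact hroot ((hf.inj i (List.mem_cons_of_mem _ hi) root List.mem_cons_self _ _ _ _ h).1 ▸ hi)
  · refine List.nodup_flatMap.2 ⟨fun v _ => ?_, hcs.imp fun {v v'} hv x hx hx' => ?_⟩
    · exact hrest.map_on fun i hi j hj h => (hinj i hi j hj u v u v h).1
    · obtain ⟨i, hi, rfl⟩ := List.mem_map.1 hx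
      obtain ⟨j, hj, h⟩ := List.mem_map.1 hx'
      exact hv (hinj j hj i hi u v' u v h).2.2.symm
  · have hrow : ∀ u x, x ∈ (f root u u :: cs.flatMap fun v => rest.map fun i => f i u v) →
        ∃ i ∈ root :: rest, ∃ v, x = f i u v := fun u x hx => by
      simp only [List.mem_flatMap, List.mem_cons, List.mem_map] at hx
      obtain rfl | ⟨v, -, i, hi, rfl⟩ := hx
      · exact ⟨root, List.mem_cons_self, u, rfl⟩
      · exact ⟨i, List.mem_cons_of_mem _ hi, v, rfl⟩
    refine hcs.imp fun {u u'} hu x hx hx' => ?_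
    obtain ⟨i, hi, v, rfl⟩ := hrow u x hx
    obtain ⟨j, hj, v', h⟩ := hrow u' _ hx'
    exact hu (hf.inj i hi j hj _ _ _ _ h).2.1

/-- The item for the atom `f i u v`; nothing is read if it is not in the database. -/
def scanAtom (f : ι → Const → Const → Fact k) (l : List (Fact k)) (i : ι) (u v : Const) :
    Option ι × Option (Fact k) :=
  (some i, Option.guard (fun x => decide (x ∈ l)) (f i u v))

/-- The items for the pair `u, v` of constants. -/
def scanPair (f : ι → Const → Const → Fact k) (rest : List ι) (l : List (Fact k)) (u v : Const) :
    List (Option ι × Option (Fact k)) :=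
  rest.map (fun i => scanAtom f l i u v) ++ [(none, none)]

/-- The items for the pairs of constants with first component `u`. -/
def scanRow (f : ι → Const → Const → Fact k) (root : ι) (rest : List ι) (l : List (Fact k))
    (u : Const) : List (Option ι × Option (Fact k)) :=
  scanAtom f l root u u :: (constList l).flatMap (scanPair f rest l u)

/-- The items for all pairs of constants of the database. -/
def scanItems (f : ι → Const → Const → Fact k) (root : ι) (rest : List ι) (l : List (Fact k)) :
    List (Option ι × Option (Fact k)) :=
  (constList l).flatMap (scanRow f root rest l)

variable {f : ι → Const → Const → Fact k} {root : ι} {rest : List ι}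

theorem polyTime_scanItems [Enc ι] (hf : ∀ i, PolyTime fun p : Const × Const => f i p.1 p.2) :
    PolyTime (scanItems f root rest) := by
  have hatom : ∀ {α : Type} [Enc α] (i : ι) {L : α → List (Fact k)} {u v : α → Const},
      PolyTime L → PolyTime u → PolyTime v → PolyTime fun a => scanAtom f (L a) i (u a) (v a) :=
    fun i _ _ _ hL hu hv =>
      have hfact := (hf i).comp (hu.pair hv)
      (PolyTime.const (some i)).pair
        (.ite (.decide_mem encFact_injective hfact hL) hfact.option_some (.const none))
  have hpair : PolyTime fun x : (List (Fact k) × Const) × Const =>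
      scanPair f rest x.1.1 x.1.2 x.2 :=
    .append (.list_map rest fun i => hatom i (PolyTime.fst.comp .fst) (PolyTime.snd.comp .fst) .snd)
      (.const _)
  have hrow : PolyTime fun x : List (Fact k) × Const => scanRow f root rest x.1 x.2 :=
    (hatom root .fst .snd .snd).cons ((polyTime_constList.comp .fst).flatMap hpair)
  exact polyTime_constList.flatMap hrow

theorem readVars_map_scanAtom (l : List (Fact k)) (s : List ι) (u v : Const) :
    readVars (s.map fun i => scanAtom f l i u v) =
      (s.map fun i => f i u v).filter fun x => decide (x ∈ l) := by
  rw [readVars, List.filterMap_map, ← List.filterMap_eq_filter, List.filterMap_map]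
  rfl

theorem readVars_scanItems (l : List (Fact k)) :
    readVars (scanItems f root rest l) =
      (instances f root rest (constList l)).filter fun x => decide (x ∈ l) := by
  have hpair : ∀ u v, readVars (scanPair f rest l u v) =
      (rest.map fun i => f i u v).filter fun x => decide (x ∈ l) := fun u v => by
    rw [← readVars_map_scanAtom, readVars, scanPair, List.filterMap_append]
    exact List.append_nil _
  have hrow : ∀ u, readVars (scanRow f root rest l u) =
      (f root u u :: (constList l).flatMap fun v => rest.map fun i => f i u v).filter
        fun x => decide (x ∈ l) := fun u => by
    rw [scanRow, ← List.singleton_append, ← List.singleton_append (x := f root u u),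
      List.filter_append, List.filter_flatMap, readVars, List.filterMap_append,
      List.filterMap_flatMap]
    exact congrArg₂ _ (readVars_map_scanAtom l [root] u u)
      (congrArg (List.flatMap · _) (funext (hpair u)))
  rw [instances, List.filter_flatMap, readVars, scanItems, List.filterMap_flatMap]
  exact congrArg (List.flatMap · _) (funext hrow)

theorem run_append {A S X : Type} (δ : A → S → Bool → S) (ν : Set X) (s : S)
    (ys zs : List (A × Option X)) : run δ ν s (ys ++ zs) = run δ ν (run δ ν s ys) zs :=
  List.foldl_append

section run
variable [DecidableEq ι] {l : List (Fact k)} {ν : Set (Fact k)}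

/-- The transition function of the automaton for a hierarchical family of atoms. A state consists of
the set of the profiles recorded so far and of the profile of the current pair of constants. The
letter `some i` reads the truth value of the atom with index `i`, and `none` records the current
profile. -/
def scanStep : Option ι → Set (ι → Bool) × (ι → Bool) → Bool → Set (ι → Bool) × (ι → Bool)
  | none, q, _ => (insert q.2 q.1, q.2)
  | some i, q, b => (q.1, Function.update q.2 i b)

/-- The truth values in `D` of the atoms with indices in `s` for the constants `u` and `v`. -/
def profile (f : ι → Const → Const → Fact k) (s : List ι) (D : Database k) (u v : Const) :
    ι → Bool :=
  fun i => decide (i ∈ s ∧ f i u v ∈ D)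

theorem run_scanAtom (H : Set (ι → Bool)) (p : ι → Bool) (i : ι) (u v : Const) :
    run scanStep ν (H, p) [scanAtom f l i u v] =
      (H, Function.update p i (decide (f i u v ∈ restrict l ν))) := by
  classical
  have hread : (scanAtom f l i u v).2.any (fun x => decide (x ∈ ν)) =
      decide (f i u v ∈ restrict l ν) := by
    rw [Bool.eq_iff_iff, decide_eq_true_iff, mem_restrict]
    by_cases h : f i u v ∈ l <;> simp [scanAtom, h]
  exact congrArg (fun b => (H, Function.update p i b)) hread

theorem run_map_scanAtom (H : Set (ι → Bool)) (u v : Const) (s : List ι) (p : ι → Bool) :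
    run scanStep ν (H, p) (s.map fun i => scanAtom f l i u v) =
      (H, fun i => if i ∈ s then decide (f i u v ∈ restrict l ν) else p i) := by
  induction s generalizing p with
  | nil => simp [run]
  | cons j s ih =>
    rw [List.map_cons, ← List.singleton_append, run_append, run_scanAtom, ih]
    congr 1
    ext i
    grind [Function.update]

theorem run_flatMap {B X : Type} {ν : Set X} {g : B → List (Option ι × Option X)} {bs : List B}
    (c : B → Set (ι → Bool)) (I : (ι → Bool) → Prop)
    (hg : ∀ b ∈ bs, ∀ H p, I p →
      (run scanStep ν (H, p) (g b)).1 = H ∪ c b ∧ I (run scanStep ν (H, p) (g b)).2)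
    (H : Set (ι → Bool)) {p : ι → Bool} (hp : I p) :
    (run scanStep ν (H, p) (bs.flatMap g)).1 = H ∪ ⋃ b ∈ bs, c b ∧
      I (run scanStep ν (H, p) (bs.flatMap g)).2 := by
  induction bs generalizing H p with
  | nil => simpa [run] using hp
  | cons b bs ih =>
    obtain ⟨hc, hI⟩ := hg b List.mem_cons_self H p hp
    obtain ⟨hc', hI'⟩ := ih (fun b hb => hg b (List.mem_cons_of_mem _ hb))
      (run scanStep ν (H, p) (g b)).1 hI
    rw [List.flatMap_cons, run_append]
    refine ⟨?_, hI'⟩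
    rw [hc', hc]
    simp [Set.union_assoc]

theorem IsHierarchical.run_scanPair (hf : IsHierarchical f root rest) (H : Set (ι → Bool))
    {p : ι → Bool} {u : Const} (hp : ∀ i ∉ rest, p i = profile f [root] (restrict l ν) u u i)
    (v : Const) :
    run scanStep ν (H, p) (scanPair f rest l u v) =
      (insert (profile f (root :: rest) (restrict l ν) u v) H,
        profile f (root :: rest) (restrict l ν) u v) := by
  have hprofile : (fun i => if i ∈ rest then decide (f i u v ∈ restrict l ν) else p i) =
      profile f (root :: rest) (restrict l ν) u v := by
    funext i
    by_cases hi : i ∈ rest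
    · simp [hi, profile]
    · have hroot : i = root → f i u u = f i u v := fun h => h ▸ hf.root_eq u u v
      grind [profile]
  rw [scanPair, run_append, run_map_scanAtom, hprofile]
  rfl

theorem IsHierarchical.run_scanRow (hf : IsHierarchical f root rest) (H : Set (ι → Bool))
    {p : ι → Bool} (hp : ∀ i ∉ root :: rest, p i = false) (u : Const) :
    (run scanStep ν (H, p) (scanRow f root rest l u)).1 =
        H ∪ ⋃ v ∈ constList l, {profile f (root :: rest) (restrict l ν) u v} ∧
      ∀ i ∉ root :: rest, (run scanStep ν (H, p) (scanRow f root rest l u)).2 i = false := by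
  rw [scanRow, ← List.singleton_append, run_append, run_scanAtom]
  have hrun := run_flatMap (ν := ν) (fun v => {profile f (root :: rest) (restrict l ν) u v})
    (fun p => ∀ i ∉ rest, p i = profile f [root] (restrict l ν) u u i)
    (fun v _ H p hp => ?_) H (bs := constList l) (g := scanPair f rest l u)
    (p := Function.update p root (decide (f root u u ∈ restrict l ν))) ?_
  · refine hrun.imp_right fun hI i hi => ?_
    rw [List.mem_cons, not_or] at hi
    simp [hI i hi.2, profile, hi.1]
  · rw [hf.run_scanPair H hp v]
    refine ⟨Set.union_singleton.symm, fun i hi => ?_⟩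
    have hroot : i = root → f i u u = f i u v := fun h => h ▸ hf.root_eq u u v
    grind [profile]
  · grind [profile, Function.update]

theorem IsHierarchical.run_scanItems (hf : IsHierarchical f root rest) :
    (run scanStep ν (∅, fun _ => false) (scanItems f root rest l)).1 =
      {p | ∃ u ∈ constList l, ∃ v ∈ constList l,
        profile f (root :: rest) (restrict l ν) u v = p} := by
  rw [scanItems, (run_flatMap _ (fun p => ∀ i ∉ root :: rest, p i = false)
    (fun u _ H p hp => hf.run_scanRow H hp u) ∅ fun _ _ => rfl).1]
  ext p
  simp [eq_comm]

end run
end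

/-! ### The queries `h_{k,i}` -/

section
variable {k : ℕ}

theorem atom_zero (x y : Const) : atom k 0 x y = .R x := rfl

theorem atom_last (x y : Const) : atom k (k + 1) x y = .T y := by simp [atom]

theorem atom_mid {j : ℕ} (h0 : j ≠ 0) (hj : j - 1 < k) (x y : Const) :
    atom k j x y = .S ⟨j - 1, hj⟩ x y := by simp [atom, h0, hj]

theorem atom_inj {i j : ℕ} (hi : i ≤ k + 1) (hj : j ≤ k + 1) {x y x' y' : Const}
    (h : atom k i x y = atom k j x' y') :
    i = j ∧ (i ≠ k + 1 → x = x') ∧ (i ≠ 0 → y = y') := by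
  grind [atom]

theorem polyTime_atom (j : Fin (k + 2)) :
    PolyTime fun p : Const × Const => atom k j p.1 p.2 := by
  by_cases h0 : (j : ℕ) = 0
  · exact .of_enc_eq ((PolyTime.const (encNat 0)).node (PolyTime.toData.comp .fst)) fun x => by
      rw [h0, atom_zero]; rfl
  by_cases hj : (j : ℕ) - 1 < k
  · exact .of_enc_eq ((PolyTime.const (encNat (j - 1 + 1))).node .toData) fun x => by
      rw [atom_mid h0 hj]; rfl
  · have hlast : (j : ℕ) = k + 1 := by omega
    exact .of_enc_eq ((PolyTime.const (encNat (k + 1))).node (PolyTime.toData.comp .snd))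
      fun x => by rw [hlast, atom_last]; rfl

theorem isHierarchical_atom {s : List (Fin (k + 2))} (hs : s.Nodup)
    (hmid : ∀ j ∈ s, j ≠ 0 ∧ j ≠ Fin.last (k + 1)) :
    IsHierarchical (fun j u v => atom k (j : Fin (k + 2)) u v) 0 s where
  nodup := List.nodup_cons.2 ⟨fun h => (hmid 0 h).1 rfl, hs⟩
  root_eq _ _ _ := rfl
  inj i hi j _ u v u' v' h := by
    obtain ⟨hij, hu, hv⟩ := atom_inj (by omega) (by omega) h
    refine ⟨Fin.ext hij, hu fun hlast => ?_, fun h0 => hv (Fin.val_ne_zero_iff.2 h0)⟩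
    obtain rfl | hi := List.mem_cons.1 hi
    · simp at hlast
    · exact (hmid i hi).2 (Fin.ext hlast)

theorem isHierarchical_atom_swap {s : List (Fin (k + 2))} (hs : s.Nodup)
    (hmid : ∀ j ∈ s, j ≠ 0 ∧ j ≠ Fin.last (k + 1)) :
    IsHierarchical (fun j u v => atom k (j : Fin (k + 2)) v u) (Fin.last (k + 1)) s where
  nodup := List.nodup_cons.2 ⟨fun h => (hmid _ h).2 rfl, hs⟩
  root_eq u v v' := by rw [Fin.val_last, atom_last, atom_last]
  inj i hi j _ u v u' v' h := by
    obtain ⟨hij, hv, hu⟩ := atom_inj (by omega) (by omega) h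
    refine ⟨Fin.ext hij, hu fun h0 => ?_, fun hlast => hv fun e => hlast (Fin.ext e)⟩
    obtain rfl | hi := List.mem_cons.1 hi
    · simp at h0
    · exact (hmid i hi).1 (Fin.ext h0)

theorem left_mem_constList {l : List (Fact k)} {j : ℕ} (hj : j ≤ k) {x y : Const}
    (h : atom k j x y ∈ l) : x ∈ constList l := by
  refine mem_constList h ?_
  unfold atom
  split_ifs
  · simp [Fact.consts]
  · simp [Fact.consts]
  · omega

theorem right_mem_constList {l : List (Fact k)} {j : ℕ} (hj : j ≠ 0) {x y : Const}
    (h : atom k j x y ∈ l) : y ∈ constList l := by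
  refine mem_constList h ?_
  simp only [atom, if_neg hj]
  split_ifs <;> simp [Fact.consts]

namespace Buildable

theorem of_isHierarchical {f : Fin (k + 2) → Const → Const → Fact k} {root : Fin (k + 2)}
    {rest : List (Fin (k + 2))} (hf : IsHierarchical f root rest)
    (hpoly : ∀ i, PolyTime fun p : Const × Const => f i p.1 p.2)
    (hh : ∀ (i : Fin (k + 1)) (D : Database k), h k i D ↔
      ∃ u v, f i.castSucc u v ∈ D ∧ f i.succ u v ∈ D)
    (hconst : ∀ (i : Fin (k + 1)) (l : List (Fact k)) (u v : Const),
      f i.castSucc u v ∈ l → f i.succ u v ∈ l → u ∈ constList l ∧ v ∈ constList l)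
    (θ : Finset (Fin (k + 1))) :
    Buildable {x | ∃ j ∈ root :: rest, ∃ u v, x = f j u v} fun D =>
      ∀ i : Fin (k + 1), i.castSucc ∈ root :: rest → i.succ ∈ root :: rest →
        (h k i D ↔ i ∈ θ) := by
  refine .of_automaton (enc_option_injective enc_fin_injective) scanStep
    (fun q => ∀ i : Fin (k + 1), i.castSucc ∈ root :: rest → i.succ ∈ root :: rest →
      ((∃ p ∈ q.1, p i.castSucc = true ∧ p i.succ = true) ↔ i ∈ θ)) (∅, fun _ => false)
    (polyTime_scanItems (root := root) (rest := rest) hpoly) (fun l x hx => ?_) (fun l => ?_)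
    fun l ν => ?_
  · rw [readVars_scanItems, List.mem_filter, decide_eq_true_iff] at hx
    exact ⟨hx.2, mem_instances hx.1⟩
  · rw [readVars_scanItems]
    exact (hf.nodup_instances (nodup_constList l)).filter _
  · refine forall₃_congr fun i hi hi' => iff_congr ?_ Iff.rfl
    rw [hf.run_scanItems, hh]
    constructor
    · rintro ⟨_, ⟨u, -, v, -, rfl⟩, hp, hp'⟩
      exact ⟨u, v, (of_decide_eq_true hp).2, (of_decide_eq_true hp').2⟩
    · rintro ⟨u, v, hp, hp'⟩
      obtain ⟨hu, hv⟩ := hconst i l u v (mem_restrict.1 hp).1 (mem_restrict.1 hp').1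
      exact ⟨_, ⟨u, hu, v, hv, rfl⟩, decide_eq_true ⟨hi, hp⟩, decide_eq_true ⟨hi', hp'⟩⟩

theorem forall_lt_h_iff (m : Fin (k + 1)) (θ : Finset (Fin (k + 1))) :
    Buildable {x | ∃ j : Fin (k + 2), j ≤ m.castSucc ∧ ∃ u v, x = atom k j u v} fun D =>
      ∀ i < m, (h k i D ↔ i ∈ θ) := by
  set s := (List.finRange (k + 2)).filter fun j => j ≠ 0 ∧ j ≤ m.castSucc with hs
  have hmem : ∀ j, j ∈ s ↔ j ≠ 0 ∧ j ≤ m.castSucc := by simp [hs]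
  have hmem' : ∀ j, j ∈ 0 :: s ↔ j ≤ m.castSucc := fun j => by
    rw [List.mem_cons, hmem]
    grind
  have hscan := of_isHierarchical
    (isHierarchical_atom (s := s) ((List.nodup_finRange _).filter _) fun j hj =>
      ⟨((hmem j).1 hj).1, (((hmem j).1 hj).2.trans_lt m.castSucc_lt_last).ne⟩)
    polyTime_atom (fun _ _ => Iff.rfl)
    (fun i l u v hi hi' => ⟨left_mem_constList (Nat.lt_succ_iff.1 i.2) hi,
      right_mem_constList (Fin.val_ne_zero_iff.2 i.succ_ne_zero) hi'⟩) θ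
  simp only [hmem', Fin.castSucc_le_castSucc_iff, Fin.succ_le_castSucc_iff] at hscan
  exact hscan.congr fun D => ⟨fun H i hi => H i hi.le hi, fun H i _ hi => H i hi⟩

theorem forall_gt_h_iff (m : Fin (k + 1)) (θ : Finset (Fin (k + 1))) :
    Buildable {x | ∃ j : Fin (k + 2), m.castSucc < j ∧ ∃ u v, x = atom k j u v} fun D =>
      ∀ i > m, (h k i D ↔ i ∈ θ) := by
  set s := (List.finRange (k + 2)).filter fun j => j ≠ Fin.last (k + 1) ∧ m.castSucc < j with hs
  have hmem : ∀ j, j ∈ s ↔ j ≠ Fin.last (k + 1) ∧ m.castSucc < j := by simp [hs]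
  have hmem' : ∀ j, j ∈ Fin.last (k + 1) :: s ↔ m.castSucc < j := fun j => by
    rw [List.mem_cons, hmem]
    grind [m.castSucc_lt_last]
  have hscan := of_isHierarchical
    (isHierarchical_atom_swap (s := s) ((List.nodup_finRange _).filter _) fun j hj =>
      ⟨(m.castSucc.zero_le.trans_lt ((hmem j).1 hj).2).ne', ((hmem j).1 hj).1⟩)
    (fun j => (polyTime_atom j).comp (.pair .snd .fst)) (fun _ _ => exists_comm)
    (fun i l u v hi hi' => ⟨right_mem_constList (Fin.val_ne_zero_iff.2 i.succ_ne_zero) hi',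
      left_mem_constList (Nat.lt_succ_iff.1 i.2) hi⟩) θ
  simp only [hmem', Fin.castSucc_lt_castSucc_iff, Fin.castSucc_lt_succ_iff] at hscan
  have hU : {x | ∃ j : Fin (k + 2), m.castSucc < j ∧ ∃ u v, x = atom k j v u} =
      {x | ∃ j : Fin (k + 2), m.castSucc < j ∧ ∃ u v, x = atom k j u v} :=
    Set.ext fun x => exists_congr fun j => and_congr_right fun _ => exists_comm
  rw [hU] at hscan
  exact hscan.congr fun D => ⟨fun H i hi => H i hi hi.le, fun H i hi _ => H i hi⟩

/-- The queries on the two sides of `h_{k,m}` share no atoms. -/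
theorem forall_ne_h_iff (m : Fin (k + 1)) (θ : Finset (Fin (k + 1))) :
    Buildable Set.univ fun D => ∀ i ≠ m, (h k i D ↔ i ∈ θ) := by
  have hdisj : Disjoint {x | ∃ j : Fin (k + 2), j ≤ m.castSucc ∧ ∃ u v, x = atom k j u v}
      {x | ∃ j : Fin (k + 2), m.castSucc < j ∧ ∃ u v, x = atom k j u v} := by
    rw [Set.disjoint_left]
    rintro x ⟨i, hi, u, v, rfl⟩ ⟨j, hj, u', v', h⟩
    exact (hi.trans_lt hj).ne (Fin.ext (atom_inj (by omega) (by omega) h).1)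
  refine (((forall_lt_h_iff m θ).and (forall_gt_h_iff m θ) hdisj).mono (Set.subset_univ _)).congr
    fun D => ⟨fun H i hi => hi.lt_or_gt.elim (H.1 i) (H.2 i), fun H =>
      ⟨fun i hi => H i hi.ne, fun i hi => H i hi.ne'⟩⟩

end Buildable
end

/-! ### Sets of valuations with Euler characteristic zero -/

section
open scoped symmDiff
variable {ι : Type*} [DecidableEq ι]

/-- The Euler characteristic of a set of valuations. -/
def eulerChar {ι : Type*} (S : Finset (Finset ι)) : ℤ := ∑ ν ∈ S, (-1) ^ ν.card

theorem neg_one_pow_card_symmDiff (s t : Finset ι) :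
    (-1 : ℤ) ^ (s ∆ t).card = (-1) ^ s.card * (-1) ^ t.card := by
  have hcard : s.card + t.card = (s ∆ t).card + 2 * (s ∩ t).card := by
    have hs := Finset.card_sdiff_add_card_inter s t
    have ht := Finset.card_sdiff_add_card_inter t s
    have hst : (s ∆ t).card = (s \ t).card + (t \ s).card :=
      Finset.card_union_of_disjoint disjoint_sdiff_sdiff
    rw [Finset.inter_comm] at ht
    omega
  rw [← pow_add, hcard, pow_add, pow_mul, neg_one_sq, one_pow, mul_one]

theorem neg_one_pow_card_symmDiff_singleton (ν : Finset ι) (i : ι) :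
    (-1 : ℤ) ^ (ν ∆ {i}).card = -(-1) ^ ν.card := by
  simp [neg_one_pow_card_symmDiff]

theorem symmDiff_singleton_ne (ν : Finset ι) (i : ι) : ν ∆ {i} ≠ ν := by
  simp

theorem eulerChar_edge (ν : Finset ι) (i : ι) : eulerChar {ν, ν ∆ {i}} = 0 := by
  rw [eulerChar, Finset.sum_pair (symmDiff_singleton_ne ν i).symm,
    neg_one_pow_card_symmDiff_singleton, add_neg_cancel]

theorem eulerChar_sdiff {S T : Finset (Finset ι)} (h : T ⊆ S) :
    eulerChar (S \ T) = eulerChar S - eulerChar T :=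
  eq_sub_of_add_eq (Finset.sum_sdiff h)

theorem eulerChar_map_swap (S : Finset (Finset ι)) {u v : Finset ι} (h : Even (u ∆ v).card) :
    eulerChar (S.map (Equiv.swap u v).toEmbedding) = eulerChar S := by
  have huv : (-1 : ℤ) ^ v.card = (-1) ^ u.card := by
    rw [← symmDiff_symmDiff_cancel_left u v, neg_one_pow_card_symmDiff, h.neg_one_pow, mul_one]
  rw [eulerChar, Finset.sum_map]
  refine Finset.sum_congr rfl fun x _ => ?_
  rw [Equiv.coe_toEmbedding, Equiv.swap_apply_def]
  split_ifs with hxu hxv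
  · rw [huv, hxu]
  · rw [← huv, hxv]
  · rfl

theorem exists_odd_card_symmDiff {S : Finset (Finset ι)} (hS : eulerChar S = 0)
    {u : Finset ι} (hu : u ∈ S) : ∃ w ∈ S, Odd (u ∆ w).card := by
  by_contra! heven
  have hsign : ∀ w ∈ S, (-1 : ℤ) ^ w.card = (-1) ^ u.card := fun w hw => by
    have h := neg_one_pow_card_symmDiff u (u ∆ w)
    rwa [symmDiff_symmDiff_cancel_left, (Nat.not_odd_iff_even.1 (heven w hw)).neg_one_pow,
      mul_one] at h
  rw [eulerChar, Finset.sum_congr rfl hsign, Finset.sum_const, smul_eq_zero] at hS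
  exact hS.elim (Finset.card_ne_zero_of_mem hu) (pow_ne_zero _ (by decide))

variable [Fintype ι]

/-- The sets of valuations that are obtained from the empty set by adding disjoint edges of the
hypercube and taking complements. -/
inductive EdgeGenerated : Finset (Finset ι) → Prop
  | empty : EdgeGenerated ∅
  | union_edge {S : Finset (Finset ι)} {ν : Finset ι} {i : ι} :
      EdgeGenerated S → ν ∉ S → ν ∆ {i} ∉ S → EdgeGenerated (S ∪ {ν, ν ∆ {i}})
  | compl {S : Finset (Finset ι)} : EdgeGenerated S → EdgeGenerated Sᶜ

namespace EdgeGenerated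
variable {S : Finset (Finset ι)} {ν : Finset ι}

theorem sdiff_edge {i : ι} (hS : EdgeGenerated S) (hν : ν ∈ S) (hν' : ν ∆ {i} ∈ S) :
    EdgeGenerated (S \ {ν, ν ∆ {i}}) := by
  have h := (hS.compl.union_edge (by simpa using hν) (by simpa using hν')).compl
  rwa [Finset.compl_union, compl_compl, ← Finset.sdiff_eq_inter_compl] at h

theorem of_sdiff_edge {i : ι} (hν : ν ∈ S) (hν' : ν ∆ {i} ∈ S)
    (h : EdgeGenerated (S \ {ν, ν ∆ {i}})) : EdgeGenerated S := by
  have hS := h.union_edge (ν := ν) (i := i) (by simp) (by simp)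
  rwa [Finset.sdiff_union_of_subset
    (Finset.insert_subset hν (Finset.singleton_subset_iff.2 hν'))] at hS

theorem slide (hS : EdgeGenerated S) {a b : ι} (hν : ν ∈ S) (hν' : ν ∆ {a} ∆ {b} ∉ S) :
    EdgeGenerated (insert (ν ∆ {a} ∆ {b}) (S.erase ν)) := by
  have hνp := symmDiff_singleton_ne ν a
  have hpν' := symmDiff_singleton_ne (ν ∆ {a}) b
  by_cases hp : ν ∆ {a} ∈ S
  · convert (hS.sdiff_edge hν hp).union_edge (ν := ν ∆ {a}) (i := b) (by simp)
      (by simp [hν']) using 1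
    grind
  · convert (hS.union_edge hp hν').sdiff_edge (ν := ν) (i := a) (by simp [hν]) (by simp) using 1
    grind

theorem map_swap_two_steps (hS : EdgeGenerated S) (ν : Finset ι) (a b : ι) :
    EdgeGenerated (S.map (Equiv.swap ν (ν ∆ {a} ∆ {b})).toEmbedding) := by
  have hback : ν ∆ {a} ∆ {b} ∆ {b} ∆ {a} = ν := by simp only [symmDiff_symmDiff_cancel_right]
  suffices ∃ T, EdgeGenerated T ∧ ∀ x, x ∈ T ↔ Equiv.swap ν (ν ∆ {a} ∆ {b}) x ∈ S by
    obtain ⟨T, hT, hTS⟩ := this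
    convert hT using 1
    ext x
    rw [Finset.mem_map_equiv, Equiv.symm_swap, hTS]
  by_cases hν : ν ∈ S <;> by_cases hν' : ν ∆ {a} ∆ {b} ∈ S
  · exact ⟨S, hS, by grind⟩
  · exact ⟨_, hS.slide hν hν', by grind⟩
  · exact ⟨_, hS.slide (a := b) (b := a) hν' (by rwa [hback]), by grind⟩
  · exact ⟨S, hS, by grind⟩

/-- The permutations of the valuations that preserve the edge-generated sets. -/
def preservingPerms (ι : Type*) [DecidableEq ι] [Fintype ι] :
    Submonoid (Equiv.Perm (Finset ι)) where
  carrier := {σ | ∀ ⦃S⦄, EdgeGenerated S → EdgeGenerated (S.map σ.toEmbedding)}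
  one_mem' S hS := by
    rwa [Equiv.Perm.one_def, Equiv.refl_toEmbedding, Finset.map_refl]
  mul_mem' {σ τ} hσ hτ S hS := by
    rw [Equiv.Perm.mul_def, Equiv.trans_toEmbedding, ← Finset.map_map]
    exact hσ (hτ hS)

theorem swap_mem_preservingPerms {u v : Finset ι} (h : Even (u ∆ v).card) :
    Equiv.swap u v ∈ preservingPerms ι := by
  obtain ⟨n, hn⟩ := h.two_dvd
  induction n generalizing v with
  | zero =>
    obtain rfl : u = v := by simpa using hn
    exact Equiv.swap_self u ▸ one_mem _
  | succ n ih =>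
    obtain ⟨a, ha, b, hb, hab⟩ := Finset.one_lt_card.1 (show 1 < (u ∆ v).card by omega)
    have hcard : (u ∆ (v ∆ {a} ∆ {b})).card = 2 * n := by
      have herase : u ∆ (v ∆ {a} ∆ {b}) = ((u ∆ v).erase a).erase b := by
        ext x; grind [Finset.mem_symmDiff]
      rw [herase, Finset.card_erase_of_mem (by simp [hab.symm, hb]), Finset.card_erase_of_mem ha]
      omega
    refine SubmonoidClass.swap_mem_trans _ (ih (hcard ▸ even_two_mul n) hcard) fun S hS => ?_
    rw [Equiv.swap_comm]
    exact hS.map_swap_two_steps v a b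

theorem of_eulerChar_eq_zero (hS : eulerChar S = 0) : EdgeGenerated S := by
  induction hn : S.card using Nat.strong_induction_on generalizing S with | _ n ih => ?_
  subst hn
  obtain rfl | ⟨u, hu⟩ := S.eq_empty_or_nonempty
  · exact empty
  obtain ⟨w, hw, huw⟩ := exists_odd_card_symmDiff hS hu
  obtain ⟨i, hi⟩ := Finset.card_pos.1 huw.pos
  have heven : Even (u ∆ (w ∆ {i})).card := by
    rw [← neg_one_pow_eq_one_iff_even (by decide : (-1 : ℤ) ≠ 1), ← symmDiff_assoc,
      neg_one_pow_card_symmDiff_singleton, huw.neg_one_pow, neg_neg]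
  have hwu : w ≠ u := by rintro rfl; simp at hi
  set σ := Equiv.swap u (w ∆ {i})
  have hwS : w ∈ S.map σ.toEmbedding := by
    rw [Finset.mem_map_equiv, Equiv.symm_swap,
      Equiv.swap_apply_of_ne_of_ne hwu (symmDiff_singleton_ne w i).symm]
    exact hw
  have hwiS : w ∆ {i} ∈ S.map σ.toEmbedding := by
    rw [Finset.mem_map_equiv, Equiv.symm_swap, Equiv.swap_apply_right]
    exact hu
  have hedge : {w, w ∆ {i}} ⊆ S.map σ.toEmbedding :=
    Finset.insert_subset hwS (Finset.singleton_subset_iff.2 hwiS)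
  have hmap : EdgeGenerated (S.map σ.toEmbedding) := by
    refine of_sdiff_edge hwS hwiS (ih _ ?_ ?_ rfl)
    · simpa only [Finset.card_map] using
        Finset.card_lt_card (Finset.sdiff_ssubset hedge (Finset.insert_nonempty _ _))
    · rw [eulerChar_sdiff hedge, eulerChar_map_swap S heven, hS, eulerChar_edge, sub_zero]
  have hback := swap_mem_preservingPerms heven hmap
  rwa [Finset.map_map, ← Equiv.trans_toEmbedding, Equiv.swap_swap, Equiv.refl_toEmbedding,
    Finset.map_refl] at hback

end EdgeGenerated

end

/-! ### Safe queries have Euler characteristic zero -/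

section
variable {ι : Type*} [DecidableEq ι]

/-- The alternating sum `∑ (-1)^|s|` over the subsets `s` of `F` with union `d`. -/
def altCoverSum (F : Finset (Finset ι)) (d : Finset ι) : ℤ :=
  ∑ s ∈ F.powerset with s.biUnion id = d, (-1) ^ s.card

theorem altCoverSum_eq_zero {F : Finset (Finset ι)} {d : Finset ι} (hd : ¬ d ⊆ F.biUnion id) :
    altCoverSum F d = 0 := by
  rw [altCoverSum, Finset.filter_false_of_mem, Finset.sum_empty]
  rintro s hs rfl
  exact hd (Finset.biUnion_subset_biUnion_of_subset_left _ (Finset.mem_powerset.1 hs))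

theorem sum_powerset_filter_biUnion_subset (F : Finset (Finset ι)) (d : Finset ι) :
    ∑ s ∈ F.powerset with s.biUnion id ⊆ d, (-1 : ℤ) ^ s.card =
      if {C ∈ F | C ⊆ d} = ∅ then 1 else 0 := by
  have hfilter : {s ∈ F.powerset | s.biUnion id ⊆ d} = {C ∈ F | C ⊆ d}.powerset := by
    ext s
    simp only [Finset.mem_filter, Finset.mem_powerset, Finset.biUnion_subset, id,
      Finset.subset_iff (s₁ := s)]
    exact forall₂_and.symm
  rw [hfilter, Finset.sum_powerset_neg_one_pow_card]

theorem eulerChar_hittingSets [Fintype ι] (F : Finset (Finset ι)) :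
    eulerChar {ν : Finset ι | ∀ C ∈ F, (C ∩ ν).Nonempty} = altCoverSum F Finset.univ := by
  have hhits : ∀ ν : Finset ι, (∀ C ∈ F, (C ∩ ν).Nonempty) ↔ {C ∈ F | C ⊆ νᶜ} = ∅ := fun ν => by
    simp only [Finset.filter_eq_empty_iff, Finset.subset_compl_iff_disjoint_right,
      Finset.disjoint_iff_inter_eq_empty, Finset.nonempty_iff_ne_empty, ne_eq]
  have hcompl : ∀ s : Finset (Finset ι),
      Finset.univ.filter (fun ν => s.biUnion id ⊆ νᶜ) = (s.biUnion id)ᶜ.powerset := fun s => by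
    ext ν
    rw [Finset.mem_filter_univ, Finset.mem_powerset, Finset.subset_compl_comm]
  calc eulerChar {ν : Finset ι | ∀ C ∈ F, (C ∩ ν).Nonempty}
      = ∑ ν : Finset ι, (∑ s ∈ F.powerset with s.biUnion id ⊆ νᶜ, (-1) ^ s.card) *
          (-1) ^ ν.card := by
        simp only [eulerChar, hhits,
          ← Finset.sum_filter, sum_powerset_filter_biUnion_subset, ite_mul, one_mul, zero_mul]
    _ = ∑ s ∈ F.powerset, (-1) ^ s.card * ∑ ν ∈ (s.biUnion id)ᶜ.powerset, (-1) ^ ν.card := by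
        simp only [Finset.sum_filter, Finset.sum_mul, ite_mul, zero_mul]
        rw [Finset.sum_comm]
        simp only [← Finset.sum_filter, Finset.mul_sum, hcompl]
    _ = altCoverSum F Finset.univ := by
        simp only [Finset.sum_powerset_neg_one_pow_card, Finset.compl_eq_empty_iff, mul_ite,
          mul_one, mul_zero, ← Finset.sum_filter, altCoverSum]

end

section
variable {k : ℕ}

instance {F : Finset (Finset (Fin (k + 1)))} : OrderTop (CNFLattice F) where
  top := latTop F
  le_top x := Finset.empty_subset (OrderDual.ofDual x.1)

theorem eq_top_iff_forall_not_subset {F : Finset (Finset (Fin (k + 1)))} (hF : ∅ ∉ F)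
    (x : CNFLattice F) : x = ⊤ ↔ ∀ C ∈ F, ¬ C ⊆ OrderDual.ofDual x.1 := by
  constructor
  · rintro rfl C hC hCtop
    exact hF (Finset.subset_empty.1 hCtop ▸ hC)
  · obtain ⟨x, s, hs, hx⟩ := x
    intro hnot
    obtain rfl : s = ∅ := Finset.eq_empty_of_forall_notMem fun C hC =>
      hnot C (hs hC) (hx.symm ▸ Finset.subset_biUnion_of_mem id hC)
    exact Subtype.ext hx

theorem sum_altCoverSum {F : Finset (Finset (Fin (k + 1)))} (hF : ∅ ∉ F) (x : CNFLattice F) :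
    ∑ y ∈ Finset.Icc x ⊤, altCoverSum F (OrderDual.ofDual y.1) = if x = ⊤ then 1 else 0 := by
  have hfilter : F.powerset.filter (fun s => s.biUnion id ⊆ OrderDual.ofDual x.1) =
      (Finset.Icc x ⊤).biUnion fun y =>
        F.powerset.filter fun s => s.biUnion id = OrderDual.ofDual y.1 := by
    ext s
    simp only [Finset.mem_filter, Finset.mem_biUnion, Finset.mem_Icc, le_top, and_true,
      Finset.mem_powerset]
    constructor
    · rintro ⟨hs, hsx⟩
      exact ⟨⟨OrderDual.toDual (s.biUnion id), s, hs, rfl⟩, hsx, hs, rfl⟩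
    · rintro ⟨y, hxy, hs, hsy⟩
      exact ⟨hs, hsy ▸ hxy⟩
  have hdisjoint : (↑(Finset.Icc x ⊤) : Set (CNFLattice F)).PairwiseDisjoint fun y =>
      F.powerset.filter fun s => s.biUnion id = OrderDual.ofDual y.1 := fun y _ z _ hyz =>
    Finset.disjoint_filter.2 fun s _ hsy hsz =>
      hyz (Subtype.ext (OrderDual.ofDual.injective (hsy.symm.trans hsz)))
  simp only [altCoverSum]
  rw [← Finset.sum_biUnion hdisjoint, ← hfilter, sum_powerset_filter_biUnion_subset]
  exact if_congr (Finset.filter_eq_empty_iff.trans (eq_top_iff_forall_not_subset hF x).symm) rfl rfl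

theorem eq_mu_top {α 𝕜 : Type*} [Ring 𝕜] [PartialOrder α] [OrderTop α] [LocallyFiniteOrder α]
    [DecidableEq α] {f : α → 𝕜} (hf : ∀ x, ∑ y ∈ Finset.Icc x ⊤, f y = if x = ⊤ then 1 else 0)
    (x : α) : f x = IncidenceAlgebra.mu 𝕜 x ⊤ := by
  simp only [Finset.Icc_top] at hf
  rw [IncidenceAlgebra.moebius_inversion_top f _ fun x => (hf x).symm,
    Finset.sum_eq_single_of_mem ⊤ (Finset.mem_Ici.2 le_top)
      fun y _ hy => by rw [if_neg hy, mul_zero],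
    if_pos rfl, mul_one]

theorem cnfMoebius_eq_altCoverSum {F : Finset (Finset (Fin (k + 1)))} (hF : ∅ ∉ F) :
    cnfMoebius F = altCoverSum F (F.biUnion id) := by
  classical
  exact (eq_mu_top (f := fun x : CNFLattice F => altCoverSum F (OrderDual.ofDual x.1))
    (sum_altCoverSum hF) (latBot F)).symm

/-- The valuations that satisfy `φ`. -/
def models (φ : BoolFun k) : Finset (Finset (Fin (k + 1))) :=
  Finset.univ.filter fun ν => φ ν = true

open scoped symmDiff in
theorem flip_eq_symmDiff (ν : Finset (Fin (k + 1))) (l : Fin (k + 1)) : flip ν l = ν ∆ {l} := by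
  unfold flip
  ext i
  grind [Finset.mem_symmDiff]

theorem eulerChar_models_of_not_nondegenerate {φ : BoolFun k} (hφ : ¬ Nondegenerate φ) :
    eulerChar (models φ) = 0 := by
  obtain ⟨l, hl⟩ : ∃ l, ∀ ν, φ ν = φ (flip ν l) := by
    simpa only [Nondegenerate, DependsOn, ne_eq, not_forall, not_exists, not_not] using hφ
  simp only [flip_eq_symmDiff] at hl
  refine Finset.sum_involution (fun ν _ => symmDiff ν {l}) (fun ν _ => ?_)
    (fun ν _ _ => symmDiff_singleton_ne ν l) (fun ν hν => ?_)
    fun ν _ => symmDiff_symmDiff_cancel_right _ _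
  · rw [neg_one_pow_card_symmDiff_singleton, add_neg_cancel]
  · simpa only [models, Finset.mem_filter_univ, ← hl] using hν

theorem eulerChar_models_of_isMinCNF {F : Finset (Finset (Fin (k + 1)))} {φ : BoolFun k}
    (hF : IsMinCNF F φ) (hmu : cnfMoebius F = 0) : eulerChar (models φ) = 0 := by
  simp only [models, hF.1]
  by_cases hempty : ∅ ∈ F
  · rw [Finset.filter_false_of_mem fun ν _ hν => by simpa using hν ∅ hempty]
    exact Finset.sum_empty
  rw [eulerChar_hittingSets]
  by_cases hcover : F.biUnion id = Finset.univ
  · rw [← hcover, ← cnfMoebius_eq_altCoverSum hempty, hmu]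
  · exact altCoverSum_eq_zero fun h => hcover (Finset.univ_subset_iff.1 h)

theorem eulerChar_models_of_isSafe {φ : BoolFun k} (hφ : IsSafe φ) : eulerChar (models φ) = 0 := by
  obtain hdeg | ⟨F, hF, hmu⟩ := hφ
  · exact eulerChar_models_of_not_nondegenerate hdeg
  · exact eulerChar_models_of_isMinCNF hF hmu

end

section
variable {k : ℕ}
open scoped symmDiff

theorem mem_edge_iff_forall_ne (ν μ : Finset (Fin (k + 1))) (m : Fin (k + 1)) :
    μ ∈ ({ν, ν ∆ {m}} : Finset (Finset (Fin (k + 1)))) ↔ ∀ i ≠ m, (i ∈ μ ↔ i ∈ ν) := by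
  rw [Finset.mem_insert, Finset.mem_singleton]
  constructor
  · rintro (rfl | rfl) i hi
    · rfl
    · simp [Finset.mem_symmDiff, hi]
  · intro h
    by_cases hm : m ∈ μ ↔ m ∈ ν
    · refine Or.inl (Finset.ext fun i => ?_)
      obtain rfl | hi := eq_or_ne i m
      exacts [hm, h i hi]
    · refine Or.inr (Finset.ext fun i => ?_)
      obtain rfl | hi := eq_or_ne i m
      · simp only [Finset.mem_symmDiff, Finset.mem_singleton]; tauto
      · simp [Finset.mem_symmDiff, hi, h i hi]

open Classical in
theorem EdgeGenerated.buildable {S : Finset (Finset (Fin (k + 1)))} (hS : EdgeGenerated S) :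
    Buildable Set.univ fun D => (Finset.univ.filter fun i => h k i D) ∈ S := by
  induction hS with
  | empty =>
    exact (Buildable.const_false.mono (Set.empty_subset _)).congr fun D =>
      (iff_false_intro (Finset.notMem_empty _)).symm
  | @union_edge S ν m _ hν hν' ih =>
    have hedge : Buildable Set.univ fun D =>
        (Finset.univ.filter fun i => h k i D) ∈ ({ν, ν ∆ {m}} : Finset _) :=
      (Buildable.forall_ne_h_iff m ν).congr fun D => by
        simp only [mem_edge_iff_forall_ne, Finset.mem_filter_univ]
    have hor := ih.or hedge fun D hD => Finset.disjoint_left.1 (by simp [hν, hν']) hD.1 hD.2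
    exact (hor.mono (Set.union_self _).subset).congr fun D => Finset.mem_union.symm
  | compl _ ih => exact ih.not.congr fun D => Finset.mem_compl.symm

end
end HQuery

theorem mainTheorem2_general {k : ℕ} (φ : HQuery.BoolFun k)
    (hφ : HQuery.eulerChar (HQuery.models φ) = 0) : HQuery.InDDPTIME (HQuery.Qof φ) :=
  ((HQuery.EdgeGenerated.of_eulerChar_eq_zero hφ).buildable.congr fun D => by
    simp only [HQuery.models, HQuery.Qof, Finset.mem_filter_univ]).inDDPTIME

/-- All safe `H⁺`-queries have d-D lineages computable in polynomial time. -/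
theorem mainTheorem2 (k : ℕ) (hk : 1 ≤ k) (φ : HQuery.BoolFun k) (hmono : Monotone φ)
    (hsafe : HQuery.IsSafe φ) : HQuery.InDDPTIME (HQuery.Qof φ) :=
  mainTheorem2_general φ (HQuery.eulerChar_models_of_isSafe hsafe)
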